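/- **Setting.** Let $m\ge 1$, $0<\lambda<\infty$, $\mu<1$, $a=b_0,b_1,\dots,b_m\in\mathbb C$, $A_0=1$, $A_1,\dots,A_m\in\mathbb C$, and let $\zeta_0=1,\zeta_1,\dots,\zeta_m$ be pairwise distinct complex numbers of modulus $1$. Let $\theta\in(0,\pi)$ satisfy $\lambda\theta<2\pi$ and be so small that the sectors $|\arg(z/\zeta_k)|\le\theta$ ($z\ne0$), $k=0,\dots,m$, are pairwise disjoint. All powers, logarithms and arguments are principal. Let $f$ be an entire function such that, as $|z|\to\infty$, \[ f(z)=A_k(z/\zeta_k)^{b_k}\exp\!\big((z/\zeta_k)^\lambda\big)\,[1+o(1)]\quad\text{for } |\arg(z/\zeta_k)|\le\theta,\qquad k=0,1,\dots,m, \] and $f(z)=O(\exp(\mu|z|^\lambda))$ for all other $z$, each estimate holding uniformly in its sector. Let \[ p_n(z)=\sum_{k=0}^n\frac{f^{(k)}(0)}{k!}z^k,\qquad r_n=(n/\lambda)^{1/\lambda}, \] \[ S=\{z\in\mathbb C:|z^\lambda\exp(1-z^\lambda)|=1,\ |z|\le1\}. \] Let $\xi\in S$ with $|\arg\xi|<\theta$,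 $\xi\ne1$, put $\tau=\operatorname{Im}(\xi^\lambda-1-\lambda\log\xi)$, and let $\tau_n\in(-\pi,\pi]$ with $\tau_n\equiv\tau n/\lambda\pmod{2\pi}$. For $j\in\{0,\dots,m\}$ let $\sigma_n^{(j)}\in(-\pi,\pi]$ with $\sigma_n^{(j)}\equiv n\arg\zeta_j\pmod{2\pi}$. Define \[ z_n(w)=\xi\Big[1+\frac{\log n}{2(1-\xi^\lambda)n}-\frac{w-i\tau_n}{(1-\xi^\lambda)n}\Big], \] \[ z_n^{(j)}(w)=\xi\Big[1+\Big(a-b_j+\frac\lambda2\Big)\frac{\log n}{\lambda(1-\xi^\lambda)n}-\frac{w-i\sigma_n^{(j)}-i\tau_n}{(1-\xi^\lambda)n}\Big]. \] **Theorem.** In each of the following statements, for every compact $K\subset\mathbb C$ the denominator of the quotient on the left has no zeros $w\in K$ once $n$ is large, and the limit, respectively the $o(1)$, as $n\to\infty$ is uniform for $w\in K$. (1) If there is $j\in\{0,\dots,m\}$ with $\operatorname{Re}b_j>\operatorname{Re}b_k$ for all $k\ne j$, then \[ \lim_{n\to\infty}\frac{p_{n-1}(r_nz_n^{(j)}(w))}{f(r_nz_n^{(j)}(w))}=1-\frac{A_j\zeta_j\lambda^{(a-b_j)/\lambda}e^{-w}}{\xi^a(\zeta_j-\xi)\sqrt{2\pi\lambda}}.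 \] (2) If $m=2$ and $\operatorname{Re}a=\operatorname{Re}b_1>\operatorname{Re}b_2$, then \[ \frac{p_{n-1}(r_nz_n(w))}{f(r_nz_n(w))}=1-\Big(\frac1{1-\xi}+\frac{A_1\zeta_1^{1-n}r_n^{b_1-a}}{\zeta_1-\xi}\Big)\frac{e^{-w}}{\xi^a\sqrt{2\pi\lambda}}+o(1). \] (3) If $m=2$ and $\operatorname{Re}a=\operatorname{Re}b_1=\operatorname{Re}b_2$, then \[ \frac{p_{n-1}(r_nz_n(w))}{f(r_nz_n(w))}=1-\Big(\frac1{1-\xi}+\frac{A_1\zeta_1^{1-n}r_n^{b_1-a}}{\zeta_1-\xi}+\frac{A_2\zeta_2^{1-n}r_n^{b_2-a}}{\zeta_2-\xi}\Big)\frac{e^{-w}}{\xi^a\sqrt{2\pi\lambda}}+o(1). \] (4) If $m=2$ and $\operatorname{Re}b_1=\operatorname{Re}b_2>\operatorname{Re}a$, then \[ \frac{p_{n-1}(r_nz_n^{(1)}(w))}{f(r_nz_n^{(1)}(w))}=1-\Big(\frac{A_1}{\zeta_1-\xi}+\frac{A_2(\zeta_2/\zeta_1)^{1-n}r_n^{b_2-b_1}}{\zeta_2-\xi}\Big)\frac{\zeta_1\lambda^{(a-b_1)/\lambda}e^{-w}}{\xi^a\sqrt{2\pi\lambda}}+o(1).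 \] -/

import Mathlib

open Filter Topology Asymptotics

noncomputable section

namespace PartialSumScaling

/-- The sector `|arg (z / ω)| ≤ θ` with vertex `0` (the vertex, where `arg` is meaningless, is
excluded). -/
def sector (ω : ℂ) (θ : ℝ) : Set ℂ :=
  {z : ℂ | z ≠ 0 ∧ |Complex.arg (z / ω)| ≤ θ}

/-- `f` is an entire function with the `m + 1` directions of maximal exponential growth
`ζ 0 = 1, ζ 1, …, ζ m`: as `|z| → ∞`,
`f z = A k * (z / ζ k) ^ (b k) * exp ((z / ζ k) ^ lam) * (1 + o(1))` uniformly in the sector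
`|arg (z / ζ k)| ≤ θ`, for each `k`, and `f z = O (exp (μ |z| ^ lam))` uniformly in the rest of the
plane, where `μ < 1`.  The first direction is normalised by `ζ 0 = 1` and `A 0 = 1`;
its exponent `b 0` is also called `a`. -/
structure HasMaximalGrowth (m : ℕ) (lam θ μ : ℝ) (b A ζ : Fin (m + 1) → ℂ) (f : ℂ → ℂ) :
    Prop where
  entire : Differentiable ℂ f
  lam_pos : 0 < lam
  mu_lt_one : μ < 1
  theta_pos : 0 < θ
  theta_lt_pi : θ < Real.pi
  /-- The ray `arg z = 0` is the only one in `|arg z| ≤ θ` on which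
  `|exp (z ^ lam)| = exp (|z| ^ lam)`. -/
  lam_mul_theta_lt : lam * θ < 2 * Real.pi
  zeta_zero : ζ 0 = 1
  A_zero : A 0 = 1
  norm_zeta : ∀ k, ‖ζ k‖ = 1
  zeta_injective : Function.Injective ζ
  sectors_disjoint : Pairwise fun j k => Disjoint (sector (ζ j) θ) (sector (ζ k) θ)
  growth : ∀ k,
    f ~[Bornology.cobounded ℂ ⊓ 𝓟 (sector (ζ k) θ)]
      fun z => A k * (z / ζ k) ^ (b k) * Complex.exp ((z / ζ k) ^ (lam : ℂ))
  small : f =O[Bornology.cobounded ℂ ⊓ 𝓟 (⋃ k, sector (ζ k) θ)ᶜ] fun z => Real.exp (μ * ‖z‖ ^ lam)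

/-- The partial sum `p_n(z) = ∑_{k=0}^{n} f⁽ᵏ⁾(0) / k! * z ^ k` of the Maclaurin series of `f`. -/
def partialSum (f : ℂ → ℂ) (n : ℕ) (z : ℂ) : ℂ :=
  ∑ k ∈ Finset.range (n + 1), iteratedDeriv k f 0 / (k.factorial : ℂ) * z ^ k

/-- `r_n = (n / lam) ^ (1 / lam)`. -/
def scaleRadius (lam : ℝ) (n : ℕ) : ℝ := ((n : ℝ) / lam) ^ (1 / lam)

/-- The limit curve `S`. -/
def limitCurve (lam : ℝ) : Set ℂ :=
  {z : ℂ | ‖z ^ (lam : ℂ) * Complex.exp (1 - z ^ (lam : ℂ))‖ = 1 ∧ ‖z‖ ≤ 1}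

/-- The representative of `x` modulo `2π` in the interval `(-π, π]`. -/
def angleRep (x : ℝ) : ℝ := toIocMod Real.two_pi_pos (-Real.pi) x

/-- `angleRep x` is the only real `t` with `x ≡ t (mod 2π)` and `-π < t ≤ π`. -/
theorem angleRep_eq_iff (x t : ℝ) :
    angleRep x = t ↔ (-Real.pi < t ∧ t ≤ Real.pi) ∧ ∃ k : ℤ, x = t + k * (2 * Real.pi) := by
  have h : -Real.pi + 2 * Real.pi = Real.pi := by ring
  simp [angleRep, toIocMod_eq_iff, h]

/-- `τ = Im (ξ ^ lam - 1 - lam * log ξ)`. -/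
def tau (lam : ℝ) (ξ : ℂ) : ℝ := (ξ ^ (lam : ℂ) - 1 - (lam : ℂ) * Complex.log ξ).im

/-- `τ_n ≡ τ n / lam (mod 2π)`, `-π < τ_n ≤ π`. -/
def tauSeq (lam : ℝ) (ξ : ℂ) (n : ℕ) : ℝ := angleRep (tau lam ξ * n / lam)

/-- `σ_n ≡ n arg ω (mod 2π)`, `-π < σ_n ≤ π`. -/
def sigmaSeq (ω : ℂ) (n : ℕ) : ℝ := angleRep (n * Complex.arg ω)

/-- The scaling
`z_n(w) = ξ (1 + log n / (2 (1 - ξ^lam) n) - (w - i τ_n) / ((1 - ξ^lam) n))`. -/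
def scalingPoint (lam : ℝ) (ξ : ℂ) (n : ℕ) (w : ℂ) : ℂ :=
  ξ * (1 + (Real.log n : ℂ) / (2 * (1 - ξ ^ (lam : ℂ)) * n)
    - (w - Complex.I * tauSeq lam ξ n) / ((1 - ξ ^ (lam : ℂ)) * n))

/-- The scaling adapted to the direction `ω` with exponent `β`:
`z_n(w) = ξ [1 + (a - β + lam/2) log n / (lam (1 - ξ^lam) n)
  - (w - i σ_n - i τ_n) / ((1 - ξ^lam) n)]`. -/
def scalingPointDir (lam : ℝ) (a β ω ξ : ℂ) (n : ℕ) (w : ℂ) : ℂ :=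
  ξ * (1 + (a - β + lam / 2) * ((Real.log n : ℂ) / (lam * (1 - ξ ^ (lam : ℂ)) * n))
    - (w - Complex.I * sigmaSeq ω n - Complex.I * tauSeq lam ξ n)
      / ((1 - ξ ^ (lam : ℂ)) * n))

/-- `p_{n-1}(r_n z_n(w)) / f(r_n z_n(w)) = L_n(w) + o(1)` as `n → ∞`, uniformly for `w` in any
compact subset of `ℂ`.  It is part of the assertion that on every compact set the quotient is
defined (its denominator does not vanish) for all large `n`. -/
def QuotientAsymp (f : ℂ → ℂ) (lam : ℝ) (z : ℕ → ℂ → ℂ) (L : ℕ → ℂ → ℂ) : Prop :=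
  ∀ K : Set ℂ, IsCompact K →
    (∀ᶠ n : ℕ in atTop, ∀ w ∈ K, f (scaleRadius lam n * z n w) ≠ 0) ∧
    TendstoUniformlyOn
      (fun (n : ℕ) (w : ℂ) =>
        partialSum f (n - 1) (scaleRadius lam n * z n w) / f (scaleRadius lam n * z n w) - L n w)
      (fun _ => 0) atTop K

end PartialSumScaling

end

namespace PartialSumScaling

/-! For |z| < 1, Cauchy's formula writes f(rz) - p_{n-1}(rz) as z^n (2π)⁻¹ times the integral of
f(ru) u^{1-n}/(u - z) over the unit circle u = e^{it} (`sub_partialSum_eq`). The choice r = r_n,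
that is r^λ = n/λ, makes every direction ζ_k a saddle point: at u = ζ_k e^{it} the exponential part
is ζ_k^{-n} exp((n/λ)(e^{iλt} - iλt)), which is ζ_k^{-n} e^{n/λ} times nearly a Gaussian of width
n^{-1/2}. By Laplace's method the sector contributes about A_k ζ_k/(ζ_k - ξ) · √(2π/(λn)) · ζ_k^{-n}
r^{b_k} e^{n/λ} (`tendsto_sector_integral`); the rest of the circle is exponentially smaller because
μ < 1 (`tendsto_integral_compl_sectors`). Only the directions with maximal Re b_k survive
(`tendsto_remainder_integral`).

Division by f(rz) ~ (rz)^a exp((n/λ)z^λ) leaves exp(n(log z - z^λ/λ + 1/λ)). For ξ on S this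
exponent equals -iτn/λ at z = ξ; at z = ξ(1 + ε) with nε² → 0 it gains nε(1 - ξ^λ) + o(1)
(`tendsto_prefactor`). The displacement ε is chosen so that this factor cancels n^{-1/2}, the excess
power of r, the rotation ω^{-n} and the phase, leaving e^{-w} (`exp_displacement`).

All four statements are instances of `quotientAsymp_scalingPointDir`; they differ in the reference
exponent β, the reference direction ω and the set T of directions kept. -/

/-! ### Cauchy's integral for the Maclaurin remainder -/

theorem sub_taylor_eq_circleIntegral {f : ℂ → ℂ} (hf : Differentiable ℂ f) {R : ℝ} {Z : ℂ}
    (hZ : ‖Z‖ < R) (n : ℕ) :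
    f Z - ∑ k ∈ Finset.range n, iteratedDeriv k f 0 / (k.factorial : ℂ) * Z ^ k
      = Z ^ n * ((2 * Real.pi * Complex.I)⁻¹ * ∮ u in C(0, R), f u / (u ^ n * (u - Z))) := by
  have hR : 0 < R := (norm_nonneg Z).trans_lt hZ
  have hne : ∀ u ∈ Metric.sphere (0 : ℂ) R, u ≠ 0 ∧ u - Z ≠ 0 := by
    intro u hu
    rw [mem_sphere_zero_iff_norm] at hu
    constructor
    · rintro rfl
      simp at hu
      linarith
    · intro h
      rw [sub_eq_zero] at h
      subst h
      linarith
  induction n with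
  | zero =>
    have := hf.diffContOnCl.circleIntegral_sub_inv_smul (R := R) (c := 0) (w := Z) (by simpa using hZ)
    simp only [Finset.range_zero, Finset.sum_empty, sub_zero, pow_zero, one_mul]
    rw [eq_comm, inv_mul_eq_iff_eq_mul₀ Complex.two_pi_I_ne_zero, ← smul_eq_mul, ← this]
    congr 1
    ext u
    rw [smul_eq_mul]
    ring
  | succ n ih =>
    have hd := hf.diffContOnCl.circleIntegral_one_div_sub_center_pow_smul (c := 0) hR n
    have hcI : ∀ g : ℂ → ℂ, ContinuousOn g (Metric.sphere 0 R) → CircleIntegrable g 0 R :=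
      fun g hg => hg.circleIntegrable hR.le
    -- The identity 1/(u^n (u - Z)) = 1/u^{n+1} + Z/(u^{n+1}(u - Z)) peels off one Taylor
    -- coefficient.
    have hsplit : (∮ u in C(0, R), f u / (u ^ n * (u - Z)))
        = (∮ u in C(0, R), (1 / (u - 0) ^ (n + 1)) • f u)
          + Z * ∮ u in C(0, R), f u / (u ^ (n + 1) * (u - Z)) := by
      rw [← circleIntegral.integral_const_mul, ← circleIntegral.integral_add]
      · refine circleIntegral.integral_congr hR.le fun u hu => ?_
        obtain ⟨h1, h2⟩ := hne u hu
        simp only [sub_zero, smul_eq_mul]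
        field_simp
        ring
      · have h1 : ContinuousOn (fun u : ℂ => 1 / (u - 0) ^ (n + 1)) (Metric.sphere 0 R) :=
          ContinuousOn.div (by fun_prop) (by fun_prop) fun u hu => by
            simpa using fun h => (hne u hu).1 h
        exact hcI _ (h1.smul hf.continuous.continuousOn)
      · refine hcI _ (ContinuousOn.mul (by fun_prop)
          (ContinuousOn.div hf.continuous.continuousOn (by fun_prop) ?_))
        intro u hu
        exact mul_ne_zero (pow_ne_zero _ (hne u hu).1) (hne u hu).2
    rw [Finset.sum_range_succ, ← sub_sub, ih, hsplit, hd, smul_eq_mul]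
    have := Complex.two_pi_I_ne_zero
    have h3 : (n.factorial : ℂ) ≠ 0 := by exact_mod_cast n.factorial_ne_zero
    field_simp
    ring

/-- The integrand, on the unit circle, of the remainder of the Maclaurin expansion. -/
noncomputable def remainderKernel (f : ℂ → ℂ) (r : ℝ) (n : ℕ) (z u : ℂ) : ℂ :=
  f (r * u) * u / (u ^ n * (u - z))

/-- Rescaling the circle to radius 1 trades (rz)^n for z^n, and du = iu dt puts the extra u into the
kernel. The window [-π, π] matches the range of the principal argument. -/
theorem sub_partialSum_eq {f : ℂ → ℂ} (hf : Differentiable ℂ f) {n : ℕ} (hn : n ≠ 0) {r : ℝ}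
    (hr : 0 < r) {z : ℂ} (hz : ‖z‖ < 1) :
    f (r * z) - partialSum f (n - 1) (r * z)
      = z ^ n * ((2 * Real.pi : ℂ)⁻¹ * ∫ t in (-Real.pi)..Real.pi,
          remainderKernel f r n z (Complex.exp (t * Complex.I))) := by
  have hrc : (r : ℂ) ≠ 0 := by exact_mod_cast hr.ne'
  have hZ : ‖(r : ℂ) * z‖ < r := by
    rw [norm_mul, Complex.norm_real, Real.norm_of_nonneg hr.le]
    nlinarith
  have h := sub_taylor_eq_circleIntegral hf hZ n
  rw [partialSum, Nat.sub_add_cancel (Nat.one_le_iff_ne_zero.2 hn), h, circleIntegral]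
  have hper : Function.Periodic
      (fun t : ℝ => remainderKernel f r n z (Complex.exp (t * Complex.I))) (2 * Real.pi) := by
    intro t
    simp only
    congr 1
    rw [Complex.exp_eq_exp_iff_exists_int]
    exact ⟨1, by push_cast; ring⟩
  have h2 := hper.intervalIntegral_add_eq (-Real.pi) 0
  rw [show -Real.pi + 2 * Real.pi = Real.pi by ring, zero_add] at h2
  rw [h2]
  have h3 : ∀ t : ℝ, deriv (circleMap 0 r) t •
      (f (circleMap 0 r t) / (circleMap 0 r t ^ n * (circleMap 0 r t - r * z)))
      = (Complex.I * (r : ℂ)⁻¹ ^ n) * remainderKernel f r n z (Complex.exp (t * Complex.I)) := by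
    intro t
    have he := Complex.exp_ne_zero (t * Complex.I)
    have hne : Complex.exp (t * Complex.I) - z ≠ 0 := by
      intro h0
      rw [sub_eq_zero] at h0
      rw [← h0, Complex.norm_exp_ofReal_mul_I] at hz
      exact lt_irrefl _ hz
    rw [deriv_circleMap, circleMap, remainderKernel, smul_eq_mul, zero_add, ← mul_sub]
    simp only [mul_pow, inv_pow]
    field_simp
  simp_rw [h3]
  rw [intervalIntegral.integral_const_mul]
  have hI := Complex.I_ne_zero
  have hpi : (Real.pi : ℂ) ≠ 0 := by exact_mod_cast Real.pi_ne_zero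
  simp only [mul_pow, inv_pow]
  field_simp

theorem continuous_remainderKernel {f : ℂ → ℂ} (hf : Continuous f) (r : ℝ) (n : ℕ) {z : ℂ}
    (hz : ‖z‖ < 1) {u : ℝ → ℂ} (hu : Continuous u) (hu1 : ∀ t, ‖u t‖ = 1) :
    Continuous fun t => remainderKernel f r n z (u t) := by
  unfold remainderKernel
  refine Continuous.div (by fun_prop) (by fun_prop) fun t => ?_
  refine mul_ne_zero (pow_ne_zero _ ?_) ?_
  · intro h
    simpa [h] using hu1 t
  · intro h
    rw [sub_eq_zero] at h
    rw [← h, hu1] at hz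
    exact lt_irrefl _ hz

theorem norm_remainderKernel_le {f : ℂ → ℂ} {r : ℝ} {n : ℕ} {z u : ℂ} (hu : ‖u‖ = 1)
    {δ : ℝ} (hδ : 0 < δ) (hz : ‖z‖ ≤ 1 - δ) :
    ‖remainderKernel f r n z u‖ ≤ ‖f (r * u)‖ * δ⁻¹ := by
  rw [remainderKernel, norm_div, norm_mul, norm_mul, norm_pow, hu, one_pow, mul_one, one_mul,
    div_eq_mul_inv]
  have : δ ≤ ‖u - z‖ := by
    have := norm_sub_norm_le u z
    linarith
  gcongr

/-! ### Splitting the circle into sectors -/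

theorem sector_iff_of_norm {ω : ℂ} {θ t : ℝ} (hω : ‖ω‖ = 1) (ht : t ∈ Set.Ioc (-Real.pi) Real.pi)
    {r : ℝ} (hr : 0 < r) :
    (r : ℂ) * (ω * Complex.exp (t * Complex.I)) ∈ sector ω θ ↔ |t| ≤ θ := by
  have h0 : ω ≠ 0 := by
    rintro rfl
    simp at hω
  have hrc : (r : ℂ) ≠ 0 := by exact_mod_cast hr.ne'
  have h1 : (r : ℂ) * (ω * Complex.exp (t * Complex.I)) / ω = r * Complex.exp (t * Complex.I) := by
    field_simp
  have h2 : Complex.arg (r * Complex.exp (t * Complex.I)) = t := by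
    rw [Complex.arg_real_mul _ hr, Complex.arg_exp_mul_I, toIocMod_eq_self]
    convert! ht using 1
    congr 1
    ring
  simp only [sector, Set.mem_ofPred_eq, h1, h2]
  simp [h0, hrc, Complex.exp_ne_zero]

theorem measurableSet_sector (ω : ℂ) (θ : ℝ) : MeasurableSet (sector ω θ) := by
  refine MeasurableSet.inter (measurableSet_singleton (0 : ℂ)).compl ?_
  have h : Measurable fun z : ℂ => |(z / ω).arg| :=
    (Complex.measurable_arg.comp (measurable_id.div_const ω)).norm
  exact measurableSet_le h measurable_const

/-- The integral over the unit circle of the part of a function supported in a sector. -/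
theorem integral_indicator_sector {ω : ℂ} {θ : ℝ} (hω : ‖ω‖ = 1) (hθ : 0 < θ) (hθπ : θ < Real.pi)
    (H : ℂ → ℂ) :
    (∫ t in (-Real.pi)..Real.pi, (sector ω θ).indicator H (Complex.exp (t * Complex.I)))
      = ∫ t in (-θ)..θ, H (ω * Complex.exp (t * Complex.I)) := by
  have hper : Function.Periodic
      (fun t : ℝ => (sector ω θ).indicator H (Complex.exp (t * Complex.I))) (2 * Real.pi) := by
    intro t
    simp only
    congr 1
    rw [Complex.exp_eq_exp_iff_exists_int]
    exact ⟨1, by push_cast; ring⟩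
  -- Rotating the period window by arg ω centres the sector at t = 0, away from the cut.
  have h2 := hper.intervalIntegral_add_eq (-Real.pi) (-Real.pi + ω.arg)
  rw [show -Real.pi + 2 * Real.pi = Real.pi by ring,
    show -Real.pi + ω.arg + 2 * Real.pi = Real.pi + ω.arg by ring,
    ← intervalIntegral.integral_comp_add_right
      (fun t : ℝ => (sector ω θ).indicator H (Complex.exp (t * Complex.I)))] at h2
  rw [h2]
  have h3 : ∀ t : ℝ, Complex.exp ((t + ω.arg : ℝ) * Complex.I)
      = ω * Complex.exp (t * Complex.I) := by
    intro t
    have : ω = Complex.exp (ω.arg * Complex.I) := by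
      conv_lhs => rw [← Complex.norm_mul_exp_arg_mul_I ω, hω]
      simp
    conv_rhs => rw [this, ← Complex.exp_add]
    push_cast
    congr 1
    ring
  simp_rw [h3]
  rw [intervalIntegral.integral_of_le (by linarith [Real.pi_pos]),
    intervalIntegral.integral_of_le (by linarith),
    -- The sector is closed, so its trace is `Icc`; the extra endpoint has measure zero.
    ← MeasureTheory.integral_Icc_eq_integral_Ioc (x := -θ),
    ← MeasureTheory.integral_indicator measurableSet_Icc,
    ← MeasureTheory.integral_indicator measurableSet_Ioc]
  congr 1
  ext t
  by_cases ht : t ∈ Set.Ioc (-Real.pi) Real.pi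
  · rw [Set.indicator_of_mem ht]
    have := sector_iff_of_norm (θ := θ) hω ht one_pos
    rw [Complex.ofReal_one, one_mul] at this
    simp only [Set.indicator, this, abs_le, Set.mem_Icc]
  · rw [Set.indicator_of_notMem ht, Set.indicator_of_notMem]
    intro h
    exact ht ⟨by linarith [h.1], by linarith [h.2]⟩

theorem integral_circle_eq_sum_sectors {N : ℕ} {ζ : Fin N → ℂ} {θ : ℝ} (hζ : ∀ k, ‖ζ k‖ = 1)
    (hθ : 0 < θ) (hθπ : θ < Real.pi)
    (hdis : Pairwise fun j k => Disjoint (sector (ζ j) θ) (sector (ζ k) θ)) {H : ℂ → ℂ}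
    (hH : Continuous fun t : ℝ => H (Complex.exp (t * Complex.I))) :
    (∫ t in (-Real.pi)..Real.pi, H (Complex.exp (t * Complex.I)))
      = (∑ k, ∫ t in (-θ)..θ, H (ζ k * Complex.exp (t * Complex.I)))
        + ∫ t in (-Real.pi)..Real.pi,
            (⋃ k, sector (ζ k) θ)ᶜ.indicator H (Complex.exp (t * Complex.I)) := by
  have hmeas : Measurable fun t : ℝ => Complex.exp (t * Complex.I) := by fun_prop
  have hint : ∀ s : Set ℂ, MeasurableSet s → IntervalIntegrable
      (fun t : ℝ => s.indicator H (Complex.exp (t * Complex.I))) MeasureTheory.volume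
      (-Real.pi) Real.pi := by
    intro s hs
    have h1 := hH.intervalIntegrable (μ := MeasureTheory.volume) (-Real.pi) Real.pi
    rw [intervalIntegrable_iff] at h1 ⊢
    exact h1.indicator (hmeas hs)
  simp_rw [fun k => (integral_indicator_sector (hζ k) hθ hθπ H).symm]
  rw [← intervalIntegral.integral_finsetSum fun k _ => hint _ (measurableSet_sector _ _),
    ← intervalIntegral.integral_add]
  · congr 1
    ext t
    set u := Complex.exp (t * Complex.I)
    by_cases hu : ∃ k, u ∈ sector (ζ k) θ
    · obtain ⟨k, hk⟩ := hu
      rw [Finset.sum_eq_single k, Set.indicator_of_mem hk, Set.indicator_of_notMem, add_zero]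
      · simpa using ⟨k, hk⟩
      · intro j _ hj
        exact Set.indicator_of_notMem (fun h => (hdis hj).ne_of_mem h hk rfl) _
      · simp
    · push Not at hu
      rw [Finset.sum_eq_zero fun k _ => Set.indicator_of_notMem (hu k) _, zero_add,
        Set.indicator_of_mem]
      simpa using hu
  · have := IntervalIntegrable.sum (μ := MeasureTheory.volume) (a := -Real.pi) (b := Real.pi)
      Finset.univ (f := fun k => fun t : ℝ =>
        (sector (ζ k) θ).indicator H (Complex.exp (t * Complex.I)))
      fun k _ => hint _ (measurableSet_sector _ _)
    convert! this using 1
    ext t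
    simp
  · exact hint _ (MeasurableSet.iUnion fun k => measurableSet_sector _ _).compl

/-! ### The radius r_n and principal powers -/

theorem scaleRadius_pos {lam : ℝ} (hlam : 0 < lam) {n : ℕ} (hn : n ≠ 0) :
    0 < scaleRadius lam n := by
  have : (0 : ℝ) < n := by exact_mod_cast Nat.pos_of_ne_zero hn
  unfold scaleRadius
  positivity

/-- This is the saddle point equation: r^lam - n log r is stationary exactly when r^lam = n / lam.
-/
theorem scaleRadius_rpow {lam : ℝ} (hlam : 0 < lam) (n : ℕ) :
    scaleRadius lam n ^ lam = n / lam := by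
  rw [scaleRadius, ← Real.rpow_mul (by positivity), one_div_mul_cancel hlam.ne', Real.rpow_one]

theorem tendsto_scaleRadius {lam : ℝ} (hlam : 0 < lam) : Tendsto (scaleRadius lam) atTop atTop :=
  (tendsto_rpow_atTop (by positivity)).comp
    (tendsto_natCast_atTop_atTop.atTop_div_const hlam)

theorem ofReal_mul_cpow {r : ℝ} (hr : 0 < r) {z : ℂ} (hz : z ≠ 0) (c : ℂ) :
    ((r : ℂ) * z) ^ c = (r : ℂ) ^ c * z ^ c := by
  have hrc : (r : ℂ) ≠ 0 := by exact_mod_cast hr.ne'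
  rw [Complex.cpow_def_of_ne_zero (mul_ne_zero hrc hz), Complex.cpow_def_of_ne_zero hrc,
    Complex.cpow_def_of_ne_zero hz, Complex.log_ofReal_mul hr hz, ← Complex.exp_add,
    ← Complex.ofReal_log hr.le, add_mul]

theorem scaleRadius_mul_cpow {lam : ℝ} (hlam : 0 < lam) {n : ℕ} (hn : n ≠ 0) {z : ℂ}
    (hz : z ≠ 0) : ((scaleRadius lam n : ℂ) * z) ^ (lam : ℂ) = n / lam * z ^ (lam : ℂ) := by
  have hr := scaleRadius_pos hlam hn
  rw [ofReal_mul_cpow hr hz, ← Complex.ofReal_cpow hr.le, scaleRadius_rpow hlam]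
  push_cast
  rfl

theorem exp_mul_I_cpow {t : ℝ} (ht : t ∈ Set.Ioc (-Real.pi) Real.pi) (c : ℂ) :
    Complex.exp (t * Complex.I) ^ c = Complex.exp (c * t * Complex.I) := by
  rw [Complex.cpow_def_of_ne_zero (Complex.exp_ne_zero _), Complex.log_exp (by simpa using ht.1)
    (by simpa using ht.2)]
  congr 1
  ring

/-! ### Laplace's method in one sector -/

/-- On a compact subinterval of `(-2π, 2π)` the cosine is at most `1 - c * x ^ 2`. -/
theorem exists_cos_le_one_sub_sq {X : ℝ} (hX0 : 0 < X) (hX : X < 2 * Real.pi) :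
    ∃ c > 0, ∀ x : ℝ, |x| ≤ X → Real.cos x ≤ 1 - c * x ^ 2 := by
  set s := Real.sin (X / 2) with hs
  have hs0 : 0 < s := Real.sin_pos_of_pos_of_lt_pi (by linarith) (by linarith)
  -- The constant comes from cos x = 1 - 2 sin²(x/2) and the chord bound sin(|x|/2) ≥ (|x|/X)
  -- sin(X/2), valid by concavity since X/2 < π.
  refine ⟨2 * (s / X) ^ 2, by positivity, fun x hx => ?_⟩
  have hmem0 : (0 : ℝ) ∈ Set.Icc 0 Real.pi := ⟨le_rfl, Real.pi_pos.le⟩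
  have hmem1 : X / 2 ∈ Set.Icc 0 Real.pi := ⟨by linarith, by linarith⟩
  have hle : 0 ≤ 1 - |x| / X := by
    rw [sub_nonneg]
    exact (div_le_one hX0).2 hx
  have hconc := strictConcaveOn_sin_Icc.concaveOn.2 hmem0 hmem1 hle
    (show 0 ≤ |x| / X by positivity) (by ring)
  simp only [smul_eq_mul, mul_zero, Real.sin_zero, zero_add] at hconc
  rw [show |x| / X * (X / 2) = |x| / 2 by field_simp, ← hs] at hconc
  have h1 : (|x| / X * s) ^ 2 ≤ Real.sin (|x| / 2) ^ 2 := by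
    have : 0 ≤ |x| / X * s := by positivity
    gcongr
  have h2 : Real.cos x = 1 - 2 * Real.sin (|x| / 2) ^ 2 := by
    rw [← Real.cos_abs x, ← mul_div_cancel₀ |x| (two_ne_zero' ℝ), Real.cos_two_mul]
    have := Real.sin_sq_add_cos_sq (|x| / 2)
    simp only [mul_div_cancel_left₀ _ (two_ne_zero' ℝ)]
    linarith
  rw [h2]
  have h3 : (|x| / X * s) ^ 2 = (s / X) ^ 2 * x ^ 2 := by
    rw [← sq_abs x]
    ring
  linarith

theorem isBigO_exp_sub_quadratic :
    (fun x : ℂ => Complex.exp x - 1 - x - x ^ 2 / 2) =O[𝓝 0] fun x => x ^ 3 := by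
  refine IsBigO.of_bound (Nat.succ 3 * ((Nat.factorial 3 : ℝ) * (3 : ℕ))⁻¹) ?_
  filter_upwards [Metric.closedBall_mem_nhds (0 : ℂ) one_pos] with x hx
  have h := Complex.exp_bound (x := x) (by simpa using hx) (n := 3) (by norm_num)
  simp only [Finset.sum_range_succ, Finset.sum_range_zero] at h
  rw [norm_pow]
  rw [mul_comm]
  convert! h using 2
  simp
  ring

theorem tendsto_natCast_inv_sqrt {ι : Type*} {l : Filter ι} {n : ι → ℕ} (hn : Tendsto n l atTop) :
    Tendsto (fun q => (√(n q : ℝ))⁻¹) l (𝓝 0) :=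
  tendsto_inv_atTop_zero.comp (Real.tendsto_sqrt_atTop.comp (tendsto_natCast_atTop_atTop.comp hn))

theorem ofReal_sqrt_natCast_mul_self (n : ℕ) : ((√(n : ℝ) : ℝ) : ℂ) * ((√(n : ℝ) : ℝ) : ℂ) = n := by
  rw [← Complex.ofReal_mul, Real.mul_self_sqrt (Nat.cast_nonneg n)]
  simp

/-- The local expansion of the phase at the saddle point. -/
theorem tendsto_phase {ι : Type*} {l : Filter ι} {n : ι → ℕ} (hn : Tendsto n l atTop) {lam : ℝ}
    (hlam : 0 < lam) (s : ℝ) :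
    Tendsto (fun q => (n q : ℂ) / lam * (Complex.exp (lam * (s / √(n q : ℝ) : ℝ) * Complex.I) - 1
      - lam * (s / √(n q : ℝ) : ℝ) * Complex.I)) l (𝓝 (-(lam / 2 : ℝ) * s ^ 2 : ℝ)) := by
  have hlc : (lam : ℂ) ≠ 0 := by exact_mod_cast hlam.ne'
  have h0 : Tendsto (fun q => (lam : ℂ) * (s / √(n q : ℝ) : ℝ) * Complex.I) l (𝓝 0) := by
    have h1 : Tendsto (fun q => s / √(n q : ℝ)) l (𝓝 0) := by
      simpa [div_eq_mul_inv] using (tendsto_natCast_inv_sqrt hn).const_mul s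
    have h2 := (Complex.continuous_ofReal.tendsto 0).comp h1
    simpa using (h2.const_mul (lam : ℂ)).mul_const Complex.I
  have hO := isBigO_exp_sub_quadratic.comp_tendsto h0
  -- The cubic error is negligible: n (s/√n)^3 = O(n^{-1/2}).
  have hrest : Tendsto (fun q => (n q : ℂ) / lam * (((lam : ℂ) * (s / √(n q : ℝ) : ℝ) * Complex.I) ^ 3))
      l (𝓝 0) := by
    have h3 := h0.const_mul ((lam : ℂ) * Complex.I ^ 2 * s ^ 2)
    rw [mul_zero] at h3
    refine h3.congr' ?_
    filter_upwards [hn.eventually_ne_atTop 0] with q hq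
    have hsq := ofReal_sqrt_natCast_mul_self (n q)
    have hne : ((√(n q : ℝ) : ℝ) : ℂ) ≠ 0 := by
      intro h
      rw [h, zero_mul] at hsq
      exact hq (by exact_mod_cast hsq.symm)
    rw [← hsq]
    push_cast
    field_simp
  have h4 := ((isBigO_refl (fun q => (n q : ℂ) / lam) l).mul hO).trans_tendsto hrest
  have h5 := h4.add_const (((-(lam / 2 : ℝ) * s ^ 2 : ℝ)) : ℂ)
  rw [zero_add] at h5
  refine h5.congr' ?_
  filter_upwards [hn.eventually_ne_atTop 0] with q hq
  have hsq := ofReal_sqrt_natCast_mul_self (n q)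
  have hne : ((√(n q : ℝ) : ℝ) : ℂ) ≠ 0 := by
    intro h
    rw [h, zero_mul] at hsq
    exact hq (by exact_mod_cast hsq.symm)
  have hI := Complex.I_sq
  simp only [Function.comp]
  have h6 : (n q : ℂ) / lam * (((lam : ℂ) * (s / √(n q : ℝ) : ℝ) * Complex.I) ^ 2 / 2)
      = ((-(lam / 2 : ℝ) * s ^ 2 : ℝ) : ℂ) := by
    rw [← hsq]
    push_cast
    simp only [mul_pow, hI]
    field_simp
  rw [← h6]
  ring

/-- The real part of the phase is (n/lam)(cos(lam t) - 1). After t = s/√n the bound is a Gaussian in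
s independent of n, which serves as the dominating function. -/
theorem norm_exp_phase_le {lam θ : ℝ} (hlam : 0 < lam) {c : ℝ}
    (hc : ∀ x : ℝ, |x| ≤ lam * θ → Real.cos x ≤ 1 - c * x ^ 2) (n : ℕ) {t : ℝ} (ht : |t| ≤ θ) :
    ‖Complex.exp ((n : ℂ) / lam * (Complex.exp (lam * t * Complex.I) - 1 - lam * t * Complex.I))‖
      ≤ Real.exp (-(c * lam) * (n * t ^ 2)) := by
  rw [Complex.norm_exp, Real.exp_le_exp]
  have h1 : ((n : ℂ) / lam * (Complex.exp (lam * t * Complex.I) - 1 - lam * t * Complex.I)).re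
      = n / lam * (Real.cos (lam * t) - 1) := by
    rw [← Complex.ofReal_natCast, ← Complex.ofReal_div, Complex.re_ofReal_mul, ← Complex.ofReal_mul,
      Complex.sub_re, Complex.sub_re, Complex.exp_ofReal_mul_I_re]
    simp
  have h2 := hc (lam * t) (by rw [abs_mul, abs_of_pos hlam]; gcongr)
  rw [h1]
  calc (n : ℝ) / lam * (Real.cos (lam * t) - 1) ≤ n / lam * (-(c * (lam * t) ^ 2)) := by
        gcongr
        linarith
    _ = -(c * lam) * (n * t ^ 2) := by
        field_simp

/-- Second order Taylor estimate. -/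
theorem isBigO_sub_sub_deriv {g : ℂ → ℂ} {x : ℂ} (hg : AnalyticAt ℂ g x) :
    (fun y : ℂ => g (x + y) - g x - deriv g x * y) =O[𝓝 0] fun y => y ^ 2 := by
  obtain ⟨p, hp⟩ := hg
  have h := hp.isBigO_sub_partialSum_pow 2
  simp_rw [← norm_pow] at h
  refine h.of_norm_right.congr_left ?_
  intro y
  have h1 : p 1 (fun _ => y) = deriv g x * y := by
    rw [hp.hasDerivAt.deriv]
    simp [mul_comm]
  have h0 : p 0 (fun _ => y) = g x := hp.coeff_zero _
  rw [FormalMultilinearSeries.partialSum, Finset.sum_range_succ, Finset.sum_range_one, h1, h0]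
  ring

/-- The product with a principal filter encodes uniformity in t over the whole arc. -/
theorem tendsto_circle_sector {lam θ : ℝ} (hlam : 0 < lam) (hθπ : θ < Real.pi) {ω : ℂ}
    (hω : ‖ω‖ = 1) :
    Tendsto (fun p : ℕ × ℝ => (scaleRadius lam p.1 : ℂ) * (ω * Complex.exp (p.2 * Complex.I)))
      (atTop ×ˢ 𝓟 {t : ℝ | |t| ≤ θ}) (Bornology.cobounded ℂ ⊓ 𝓟 (sector ω θ)) := by
  have hpos : ∀ᶠ p : ℕ × ℝ in atTop ×ˢ 𝓟 {t : ℝ | |t| ≤ θ}, 0 < scaleRadius lam p.1 :=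
    (((tendsto_scaleRadius hlam).comp tendsto_fst).eventually_gt_atTop 0)
  rw [tendsto_inf, tendsto_principal]
  constructor
  · rw [← tendsto_norm_atTop_iff_cobounded]
    refine ((tendsto_scaleRadius hlam).comp tendsto_fst).congr' ?_
    filter_upwards [hpos] with p hp
    rw [norm_mul, norm_mul, hω, Complex.norm_exp_ofReal_mul_I, Complex.norm_real,
      Real.norm_of_nonneg hp.le]
    simp
  · have hmem : ∀ᶠ p : ℕ × ℝ in atTop ×ˢ 𝓟 {t : ℝ | |t| ≤ θ}, |p.2| ≤ θ :=
      tendsto_snd.eventually (eventually_mem_principal _)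
    filter_upwards [hpos, hmem] with p hp hp2
    refine (sector_iff_of_norm hω ⟨?_, ?_⟩ hp).2 hp2
    · linarith [neg_abs_le p.2]
    · linarith [le_abs_self p.2]

/-- The integrand near a direction of maximal growth, in terms of the phase. -/
theorem remainderKernel_eq {f : ℂ → ℂ} {lam : ℝ} (hlam : 0 < lam) {ω : ℂ} (hω : ‖ω‖ = 1) {A b φ : ℂ}
    {n : ℕ} (hn : n ≠ 0) {t : ℝ} (ht : t ∈ Set.Ioc (-Real.pi) Real.pi) {u : ℂ}
    (hu : u = ω * Complex.exp (t * Complex.I))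
    (hf : f (scaleRadius lam n * u) = φ * (A * (scaleRadius lam n * u / ω) ^ b
      * Complex.exp ((scaleRadius lam n * u / ω) ^ (lam : ℂ)))) (z : ℂ) :
    ω ^ n * (scaleRadius lam n : ℂ) ^ (-b) * Complex.exp (-(n / lam))
        * remainderKernel f (scaleRadius lam n) n z u
      = φ * (A * Complex.exp (b * t * Complex.I))
        * Complex.exp (n / lam * (Complex.exp (lam * t * Complex.I) - 1 - lam * t * Complex.I))
        * (u / (u - z)) := by
  have hr := scaleRadius_pos hlam hn
  have hω0 : ω ≠ 0 := by
    rintro rfl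
    simp at hω
  have hrc : (scaleRadius lam n : ℂ) ≠ 0 := by exact_mod_cast hr.ne'
  have hlc : (lam : ℂ) ≠ 0 := by exact_mod_cast hlam.ne'
  have he := Complex.exp_ne_zero (t * Complex.I)
  have h1 : scaleRadius lam n * u / ω = scaleRadius lam n * Complex.exp (t * Complex.I) := by
    rw [hu]
    field_simp
  have h2 : Complex.exp (n / lam * (Complex.exp (lam * t * Complex.I) - 1 - lam * t * Complex.I))
      = Complex.exp (n / lam * Complex.exp (lam * t * Complex.I)) * Complex.exp (-(n / lam))
        * (Complex.exp (t * Complex.I) ^ n)⁻¹ := by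
    rw [← Complex.exp_nat_mul, ← Complex.exp_neg, ← Complex.exp_add, ← Complex.exp_add]
    congr 1
    field_simp
    ring
  rw [remainderKernel, hf, h1, scaleRadius_mul_cpow hlam hn he, ofReal_mul_cpow hr he,
    exp_mul_I_cpow ht, exp_mul_I_cpow ht, h2, Complex.cpow_neg]
  have hrb : (scaleRadius lam n : ℂ) ^ b ≠ 0 := by simp [Complex.cpow_eq_zero_iff, hrc]
  have hun : u ^ n = ω ^ n * Complex.exp (t * Complex.I) ^ n := by rw [hu, mul_pow]
  rw [hun]
  have h3 : ω ^ n ≠ 0 := pow_ne_zero _ hω0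
  have h4 : Complex.exp (t * Complex.I) ^ n ≠ 0 := pow_ne_zero _ he
  -- When u = z both sides are 0 by the convention for division by zero.
  by_cases hz : u - z = 0
  · simp [hz]
  field_simp

theorem tendsto_mul_arc {lam θ : ℝ} (hlam : 0 < lam) (hθπ : θ < Real.pi) {ω : ℂ} (hω : ‖ω‖ = 1)
    {ι : Type*} {l : Filter ι} {n : ι → ℕ} (hn : Tendsto n l atTop) {t : ι → ℝ}
    (ht : ∀ᶠ q in l, |t q| ≤ θ) :
    Tendsto (fun q => (scaleRadius lam (n q) : ℂ) * (ω * Complex.exp (t q * Complex.I))) l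
      (Bornology.cobounded ℂ ⊓ 𝓟 (sector ω θ)) := by
  have h : Tendsto (fun q => (n q, t q)) l (atTop ×ˢ 𝓟 {t : ℝ | |t| ≤ θ}) :=
    hn.prodMk (tendsto_principal.2 ht)
  have h2 := (tendsto_circle_sector hlam hθπ hω).comp h
  simpa only [Function.comp_def] using h2

/-- Pointwise limit of the integrand on the scale t = s/√n: all slowly varying factors freeze at t =
0 and only the Gaussian remains. -/
theorem tendsto_phase_integrand {ι : Type*} {l : Filter ι} {n : ι → ℕ} (hn : Tendsto n l atTop)
    {z : ι → ℂ} {ξ : ℂ} (hz : Tendsto z l (𝓝 ξ)) (hξ : ‖ξ‖ < 1) {lam θ : ℝ} (hlam : 0 < lam)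
    (hθ : 0 < θ) (hθπ : θ < Real.pi) {ω A b : ℂ} (hω : ‖ω‖ = 1) {φ : ℂ → ℂ}
    (hφ : Tendsto φ (Bornology.cobounded ℂ ⊓ 𝓟 (sector ω θ)) (𝓝 1)) (s : ℝ) :
    Tendsto (fun q => φ ((scaleRadius lam (n q) : ℂ)
          * (ω * Complex.exp ((s / √(n q : ℝ) : ℝ) * Complex.I)))
        * (A * Complex.exp (b * (s / √(n q : ℝ) : ℝ) * Complex.I))
        * Complex.exp (n q / lam * (Complex.exp (lam * (s / √(n q : ℝ) : ℝ) * Complex.I) - 1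
          - lam * (s / √(n q : ℝ) : ℝ) * Complex.I))
        * (ω * Complex.exp ((s / √(n q : ℝ) : ℝ) * Complex.I)
          / (ω * Complex.exp ((s / √(n q : ℝ) : ℝ) * Complex.I) - z q))) l
      (𝓝 (A * ω / (ω - ξ) * (Real.exp (-(lam / 2) * s ^ 2) : ℂ))) := by
  have h0 : Tendsto (fun q => s / √(n q : ℝ)) l (𝓝 0) := by
    simpa [div_eq_mul_inv] using (tendsto_natCast_inv_sqrt hn).const_mul s
  have hθev : ∀ᶠ q in l, |s / √(n q : ℝ)| ≤ θ :=
    h0.abs.eventually_le_const (by simpa using hθ)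
  have hphase := (tendsto_phase hn hlam s).cexp
  have hcirc := tendsto_mul_arc hlam hθπ hω hn hθev
  have hφ1 := hφ.comp hcirc
  have hexp : Tendsto (fun q => ω * Complex.exp ((s / √(n q : ℝ) : ℝ) * Complex.I)) l (𝓝 ω) := by
    have hc : Continuous fun t : ℝ => ω * Complex.exp (t * Complex.I) := by fun_prop
    have h := (hc.tendsto 0).comp h0
    simpa [Function.comp_def] using h
  have hexpb : Tendsto (fun q => A * Complex.exp (b * (s / √(n q : ℝ) : ℝ) * Complex.I)) l
      (𝓝 A) := by
    have hc : Continuous fun t : ℝ => A * Complex.exp (b * t * Complex.I) := by fun_prop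
    have h := (hc.tendsto 0).comp h0
    simpa [Function.comp_def] using h
  have hne : ω - ξ ≠ 0 := by
    intro h
    rw [sub_eq_zero] at h
    rw [← h, hω] at hξ
    exact lt_irrefl _ hξ
  have hlim := ((hφ1.mul hexpb).mul hphase).mul (hexp.div (hexp.sub hz) hne)
  have hval : 1 * A * Complex.exp ((-(lam / 2) * s ^ 2 : ℝ) : ℂ) * (ω / (ω - ξ))
      = A * ω / (ω - ξ) * (Real.exp (-(lam / 2) * s ^ 2) : ℂ) := by
    rw [Complex.ofReal_exp]
    ring
  rw [hval] at hlim
  exact hlim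

/-- The contribution of one direction of maximal growth to the remainder. -/
theorem tendsto_sector_integral {ι : Type*} {l : Filter ι} [l.IsCountablyGenerated] {n : ι → ℕ}
    (hn : Tendsto n l atTop) {z : ι → ℂ} {ξ : ℂ} (hz : Tendsto z l (𝓝 ξ)) (hξ : ‖ξ‖ < 1)
    {f : ℂ → ℂ} (hf : Continuous f) {lam θ : ℝ} (hlam : 0 < lam) (hθ : 0 < θ) (hθπ : θ < Real.pi)
    (hlθ : lam * θ < 2 * Real.pi) {ω A b : ℂ} (hω : ‖ω‖ = 1)
    (hgrowth : f ~[Bornology.cobounded ℂ ⊓ 𝓟 (sector ω θ)]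
      fun z => A * (z / ω) ^ b * Complex.exp ((z / ω) ^ (lam : ℂ))) :
    Tendsto (fun q => (√(n q : ℝ) : ℝ) * (ω ^ n q * (scaleRadius lam (n q) : ℂ) ^ (-b)
        * Complex.exp (-(n q / lam))) * ∫ t in (-θ)..θ,
          remainderKernel f (scaleRadius lam (n q)) (n q) (z q) (ω * Complex.exp (t * Complex.I)))
      l (𝓝 (A * ω / (ω - ξ) * (√(2 * Real.pi / lam) : ℝ))) := by
  obtain ⟨φ, hφ, hfφ⟩ := hgrowth.exists_eq_mul
  obtain ⟨c, hc, hcos⟩ := exists_cos_le_one_sub_sq (mul_pos hlam hθ) hlθ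
  have hcirc := tendsto_circle_sector hlam hθπ hω
  have hφ2 : ∀ᶠ p in atTop, ∀ t ∈ {t : ℝ | |t| ≤ θ},
      ‖φ ((scaleRadius lam p : ℂ) * (ω * Complex.exp (t * Complex.I)))‖ ≤ 2 := by
    rw [← eventually_prod_principal_iff (p := fun x : ℕ × ℝ =>
      ‖φ ((scaleRadius lam x.1 : ℂ) * (ω * Complex.exp (x.2 * Complex.I)))‖ ≤ 2)]
    have := (hφ.comp hcirc).norm.eventually_le_const (u := 2) (by norm_num)
    exact this
  have hfeq := eventually_prod_principal_iff.1 (hcirc.eventually hfφ)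
  -- Half the distance from ξ to the unit circle: eventually |u - z| ≥ δ for all |u| = 1.
  set δ := (1 - ‖ξ‖) / 2 with hδ
  have hδ0 : 0 < δ := by linarith
  have hzδ : ∀ᶠ q in l, ‖z q‖ ≤ 1 - δ := hz.norm.eventually_le_const (by linarith)
  have hIoc : ∀ {t : ℝ}, |t| ≤ θ → t ∈ Set.Ioc (-Real.pi) Real.pi := fun {t} ht =>
    ⟨by linarith [neg_abs_le t], by linarith [le_abs_self t]⟩
  set κ : ι → ℝ → ℂ := fun q t => ω ^ n q * (scaleRadius lam (n q) : ℂ) ^ (-b)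
        * Complex.exp (-(n q / lam))
        * remainderKernel f (scaleRadius lam (n q)) (n q) (z q) (ω * Complex.exp (t * Complex.I))
    with hκ
  have hκeq : ∀ᶠ q in l, ∀ t : ℝ, |t| ≤ θ → κ q t
      = φ ((scaleRadius lam (n q) : ℂ) * (ω * Complex.exp (t * Complex.I)))
        * (A * Complex.exp (b * t * Complex.I))
        * Complex.exp (n q / lam * (Complex.exp (lam * t * Complex.I) - 1 - lam * t * Complex.I))
        * (ω * Complex.exp (t * Complex.I) / (ω * Complex.exp (t * Complex.I) - z q)) := by
    filter_upwards [hn.eventually hfeq, hn.eventually_ne_atTop 0] with q hq hq0 t ht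
    exact remainderKernel_eq hlam hω hq0 (hIoc ht) rfl (hq t ht) (z q)
  have hu1 : ∀ t : ℝ, ‖ω * Complex.exp (t * Complex.I)‖ = 1 := fun t => by
    rw [norm_mul, hω, Complex.norm_exp_ofReal_mul_I, one_mul]
  -- The substitution s = √n t, extended by zero, puts all the integrals on the fixed domain ℝ,
  -- ready for dominated convergence.
  set F : ι → ℝ → ℂ := fun q =>
    (Set.Ioc (√(n q : ℝ) * -θ) (√(n q : ℝ) * θ)).indicator fun s => κ q (s / √(n q : ℝ)) with hF
  have hmemF : ∀ {q : ι} {s : ℝ}, n q ≠ 0 →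
      s ∈ Set.Ioc (√(n q : ℝ) * -θ) (√(n q : ℝ) * θ) → |s / √(n q : ℝ)| ≤ θ := by
    intro q s hq hs
    have hsq : 0 < √(n q : ℝ) := Real.sqrt_pos.2 (by exact_mod_cast Nat.pos_of_ne_zero hq)
    rw [abs_div, abs_of_pos hsq, div_le_iff₀ hsq, abs_le]
    constructor <;> nlinarith [hs.1, hs.2]
  have hint : ∀ᶠ q in l, ∫ s, F q s
      = (√(n q : ℝ) : ℝ) * (ω ^ n q * (scaleRadius lam (n q) : ℂ) ^ (-b)
        * Complex.exp (-(n q / lam))) * ∫ t in (-θ)..θ,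
          remainderKernel f (scaleRadius lam (n q)) (n q) (z q)
            (ω * Complex.exp (t * Complex.I)) := by
    filter_upwards [hn.eventually_ne_atTop 0] with q hq
    have hsq : 0 < √(n q : ℝ) := Real.sqrt_pos.2 (by exact_mod_cast Nat.pos_of_ne_zero hq)
    rw [hF, MeasureTheory.integral_indicator measurableSet_Ioc,
      ← intervalIntegral.integral_of_le (by nlinarith),
      intervalIntegral.integral_comp_div _ hsq.ne', mul_div_cancel_left₀ _ hsq.ne',
      mul_div_cancel_left₀ _ hsq.ne', hκ, intervalIntegral.integral_const_mul, Complex.real_smul]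
    exact (mul_assoc _ _ _).symm
  have hlimint : ∫ s : ℝ, A * ω / (ω - ξ) * (Real.exp (-(lam / 2) * s ^ 2) : ℂ)
      = A * ω / (ω - ξ) * (√(2 * Real.pi / lam) : ℝ) := by
    rw [MeasureTheory.integral_const_mul, integral_complex_ofReal, integral_gaussian,
      show Real.pi / (lam / 2) = 2 * Real.pi / lam by field_simp]
  rw [← hlimint]
  refine Tendsto.congr' hint ?_
  refine MeasureTheory.tendsto_integral_filter_of_dominated_convergence
    (fun s => 2 * (‖A‖ * Real.exp (‖b‖ * θ)) * δ⁻¹ * Real.exp (-(c * lam) * s ^ 2)) ?_ ?_ ?_ ?_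
  · filter_upwards [hzδ] with q hq
    refine MeasureTheory.AEStronglyMeasurable.indicator (Continuous.aestronglyMeasurable ?_)
      measurableSet_Ioc
    refine (continuous_const.mul (continuous_remainderKernel hf _ _ (by linarith)
      (u := fun t : ℝ => ω * Complex.exp (t * Complex.I)) (by fun_prop) hu1)).comp
        (continuous_id.div_const _)
  · filter_upwards [hzδ, hκeq, hn.eventually hφ2, hn.eventually_ne_atTop 0]
      with q hq hκq hφq hq0
    refine Eventually.of_forall fun s => ?_
    by_cases hs : s ∈ Set.Ioc (√(n q : ℝ) * -θ) (√(n q : ℝ) * θ)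
    · have ht := hmemF hq0 hs
      have hsq : s ^ 2 = n q * (s / √(n q : ℝ)) ^ 2 := by
        have : (0 : ℝ) < n q := by exact_mod_cast Nat.pos_of_ne_zero hq0
        rw [div_pow, Real.sq_sqrt this.le]
        field_simp
      rw [hF]
      simp only
      rw [Set.indicator_of_mem hs, hκq _ ht, hsq]
      generalize s / √(n q : ℝ) = t at ht
      have h1 := norm_exp_phase_le hlam hcos (n q) ht
      have h2 : ‖Complex.exp (b * t * Complex.I)‖ ≤ Real.exp (‖b‖ * θ) := by
        refine (Complex.norm_exp_le_exp_norm _).trans (Real.exp_le_exp.2 ?_)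
        rw [norm_mul, norm_mul, Complex.norm_I, mul_one, Complex.norm_real, Real.norm_eq_abs]
        gcongr
      have h3 : ‖ω * Complex.exp (t * Complex.I) / (ω * Complex.exp (t * Complex.I) - z q)‖
          ≤ δ⁻¹ := by
        rw [norm_div, hu1, one_div]
        have := norm_sub_norm_le (ω * Complex.exp (t * Complex.I)) (z q)
        rw [hu1] at this
        gcongr
        linarith
      rw [norm_mul, norm_mul, norm_mul, norm_mul]
      calc _ ≤ 2 * (‖A‖ * Real.exp (‖b‖ * θ)) * Real.exp (-(c * lam) * (n q * t ^ 2)) * δ⁻¹ := by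
            have := hφq t ht
            gcongr
        _ = _ := by ring
    · rw [hF]
      simp only
      rw [Set.indicator_of_notMem hs, norm_zero]
      positivity
  · exact (integrable_exp_neg_mul_sq (mul_pos hc hlam)).const_mul _
  · refine Eventually.of_forall fun s => ?_
    have h0 : Tendsto (fun q => s / √(n q : ℝ)) l (𝓝 0) := by
      simpa [div_eq_mul_inv] using (tendsto_natCast_inv_sqrt hn).const_mul s
    have hθev : ∀ᶠ q in l, |s / √(n q : ℝ)| ≤ θ :=
      h0.abs.eventually_le_const (by simpa using hθ)
    have hlim := tendsto_phase_integrand hn hz hξ hlam hθ hθπ hω (A := A) (b := b) hφ s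
    refine hlim.congr' ?_
    filter_upwards [hκeq, hθev, hn.eventually_ne_atTop 0,
      h0.eventually_lt_const hθ, h0.eventually_const_lt (neg_lt_zero.2 hθ)] with q hq hqθ hq0 h1 h2
    have hsq : 0 < √(n q : ℝ) := Real.sqrt_pos.2 (by exact_mod_cast Nat.pos_of_ne_zero hq0)
    rw [div_lt_iff₀ hsq] at h1
    rw [lt_div_iff₀ hsq] at h2
    rw [hF]
    simp only
    rw [Set.indicator_of_mem (show s ∈ Set.Ioc _ _ from ⟨by linarith, by linarith⟩), hq _ hqθ]

/-! ### The arcs outside the sectors -/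

theorem real_mul_mem_sector {ω : ℂ} {θ r : ℝ} (hr : 0 < r) {z : ℂ} :
    (r : ℂ) * z ∈ sector ω θ ↔ z ∈ sector ω θ := by
  have hrc : (r : ℂ) ≠ 0 := by exact_mod_cast hr.ne'
  simp only [sector, Set.mem_ofPred_eq, mul_div_assoc, Complex.arg_real_mul _ hr]
  simp [hrc]

theorem tendsto_sqrt_mul_scaleRadius_rpow_mul_exp {lam : ℝ} (hlam : 0 < lam) {ν : ℝ} (hν : ν < 1)
    (s : ℝ) : Tendsto (fun n : ℕ => √(n : ℝ) * scaleRadius lam n ^ s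
      * (Real.exp (-(n / lam)) * Real.exp (ν * (n / lam)))) atTop (𝓝 0) := by
  have h := ((tendsto_rpow_mul_exp_neg_mul_atTop_nhds_zero (1 / 2 + s / lam) ((1 - ν) / lam)
    (div_pos (by linarith) hlam)).comp tendsto_natCast_atTop_atTop).const_mul
      ((lam ^ (s / lam))⁻¹)
  rw [mul_zero] at h
  refine h.congr' ?_
  filter_upwards [eventually_ne_atTop 0] with n hn
  have hn0 : (0 : ℝ) < n := by exact_mod_cast Nat.pos_of_ne_zero hn
  rw [Function.comp_apply, ← Real.exp_add, scaleRadius, ← Real.rpow_mul (by positivity),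
    Real.sqrt_eq_rpow, Real.rpow_add hn0, one_div_mul_eq_div, Real.div_rpow hn0.le hlam.le]
  rw [show -((1 - ν) / lam) * (n : ℝ) = -(n / lam) + ν * (n / lam) by ring]
  ring

/-- The contribution of the complement of the sectors to the remainder is negligible. -/
theorem tendsto_integral_compl_sectors {ι : Type*} {l : Filter ι} {n : ι → ℕ}
    (hn : Tendsto n l atTop) {z : ι → ℂ} {ξ : ℂ} (hz : Tendsto z l (𝓝 ξ)) (hξ : ‖ξ‖ < 1)
    {f : ℂ → ℂ} {N : ℕ} {ζ : Fin N → ℂ} {lam θ μ : ℝ} (hlam : 0 < lam) (hμ : μ < 1)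
    (hsmall : f =O[Bornology.cobounded ℂ ⊓ 𝓟 (⋃ k, sector (ζ k) θ)ᶜ]
      fun z => Real.exp (μ * ‖z‖ ^ lam))
    {ω : ℂ} (hω : ‖ω‖ = 1) (β : ℂ) :
    Tendsto (fun q => (√(n q : ℝ) : ℝ) * (ω ^ n q * (scaleRadius lam (n q) : ℂ) ^ (-β)
        * Complex.exp (-(n q / lam))) * ∫ t in (-Real.pi)..Real.pi,
          (⋃ k, sector (ζ k) θ)ᶜ.indicator
            (remainderKernel f (scaleRadius lam (n q)) (n q) (z q)) (Complex.exp (t * Complex.I)))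
      l (𝓝 0) := by
  obtain ⟨C, hC0, hC⟩ := hsmall.exists_pos
  rw [IsBigOWith, eventually_inf_principal, hasBasis_cobounded_norm.eventually_iff] at hC
  obtain ⟨R, -, hR⟩ := hC
  set δ := (1 - ‖ξ‖) / 2 with hδ
  have hδ0 : 0 < δ := by linarith
  have hzδ : ∀ᶠ q in l, ‖z q‖ ≤ 1 - δ := hz.norm.eventually_le_const (by linarith)
  have h0 := ((tendsto_sqrt_mul_scaleRadius_rpow_mul_exp hlam hμ (-β).re).comp hn).mul_const
    (C * δ⁻¹ * |Real.pi - -Real.pi|)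
  rw [zero_mul] at h0
  refine squeeze_zero_norm' ?_ h0
  filter_upwards [hzδ, hn.eventually_ne_atTop 0,
    hn.eventually ((tendsto_scaleRadius hlam).eventually_ge_atTop R)] with q hq hq0 hqR
  have hr := scaleRadius_pos hlam hq0
  have hbound : ∀ t ∈ Set.uIoc (-Real.pi) Real.pi, ‖(⋃ k, sector (ζ k) θ)ᶜ.indicator
      (remainderKernel f (scaleRadius lam (n q)) (n q) (z q)) (Complex.exp (t * Complex.I))‖
      ≤ C * Real.exp (μ * (n q / lam)) * δ⁻¹ := by
    intro t _
    have hu1 := Complex.norm_exp_ofReal_mul_I t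
    generalize Complex.exp (t * Complex.I) = u at hu1
    by_cases hu : u ∈ (⋃ k, sector (ζ k) θ)ᶜ
    · rw [Set.indicator_of_mem hu]
      refine (norm_remainderKernel_le hu1 hδ0 hq).trans ?_
      have hnorm : ‖(scaleRadius lam (n q) : ℂ) * u‖ = scaleRadius lam (n q) := by
        rw [norm_mul, hu1, mul_one, Complex.norm_real, Real.norm_of_nonneg hr.le]
      have h1 := hR (x := (scaleRadius lam (n q) : ℂ) * u) (by
        rw [Set.mem_ofPred_eq, hnorm]
        exact hqR) (by simpa [real_mul_mem_sector hr] using hu)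
      rw [hnorm, Real.norm_of_nonneg (Real.exp_pos _).le, scaleRadius_rpow hlam] at h1
      gcongr
    · rw [Set.indicator_of_notMem hu, norm_zero]
      positivity
  have h2 := intervalIntegral.norm_integral_le_of_norm_le_const hbound
  have h3 : ‖Complex.exp (-((n q : ℂ) / lam))‖ = Real.exp (-(n q / lam)) := by
    rw [Complex.norm_exp]
    congr 1
    rw [← Complex.ofReal_natCast, ← Complex.ofReal_div, ← Complex.ofReal_neg, Complex.ofReal_re]
  rw [norm_mul, norm_mul, norm_mul, norm_mul, norm_pow, hω, one_pow, one_mul, h3,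
    Complex.norm_cpow_eq_rpow_re_of_pos hr, Complex.norm_real,
    Real.norm_of_nonneg (Real.sqrt_nonneg _)]
  calc _ ≤ √(n q : ℝ) * (scaleRadius lam (n q) ^ (-β).re * Real.exp (-(n q / lam)))
        * (C * Real.exp (μ * (n q / lam)) * δ⁻¹ * |Real.pi - -Real.pi|) := by gcongr
    _ = _ := by
      simp only [Function.comp_apply]
      ring

/-! ### The limit curve and the factor z^n / f -/

theorem limitCurve_ne_zero {lam : ℝ} (hlam : 0 < lam) {ξ : ℂ} (hξ : ξ ∈ limitCurve lam) :
    ξ ≠ 0 := by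
  rintro rfl
  have hlc : (lam : ℂ) ≠ 0 := by exact_mod_cast hlam.ne'
  simpa [hlc] using hξ.1

/-- The function defining S is exp(-(ξ^lam - 1 - lam log ξ)), so modulus 1 means that the exponent
is purely imaginary, namely -iτ. -/
theorem limitCurve_re {lam : ℝ} (hlam : 0 < lam) {ξ : ℂ} (hξ : ξ ∈ limitCurve lam) :
    (ξ ^ (lam : ℂ) - 1 - lam * Complex.log ξ).re = 0 := by
  have h0 := limitCurve_ne_zero hlam hξ
  have h1 := hξ.1
  rw [show ξ ^ (lam : ℂ) * Complex.exp (1 - ξ ^ (lam : ℂ))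
    = Complex.exp (-(ξ ^ (lam : ℂ) - 1 - lam * Complex.log ξ)) by
      nth_rewrite 1 [Complex.cpow_def_of_ne_zero h0]
      rw [← Complex.exp_add]
      congr 1
      ring, Complex.norm_exp, Real.exp_eq_one_iff, Complex.neg_re, neg_eq_zero] at h1
  exact h1

/-- If |ξ| = 1, membership in S reads cos(lam arg ξ) = 1; as |lam arg ξ| < 2π, this forces arg ξ = 0
and ξ = 1. -/
theorem limitCurve_norm_lt_one {lam θ : ℝ} (hlam : 0 < lam) (hlθ : lam * θ < 2 * Real.pi) {ξ : ℂ}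
    (hξ : ξ ∈ limitCurve lam) (harg : |ξ.arg| < θ) (h1 : ξ ≠ 1) : ‖ξ‖ < 1 := by
  refine lt_of_le_of_ne hξ.2 fun hn => h1 ?_
  have h0 := limitCurve_ne_zero hlam hξ
  have hlog : Complex.log ξ = ξ.arg * Complex.I := by
    rw [Complex.log, hn]
    simp
  have hre := limitCurve_re hlam hξ
  rw [Complex.cpow_def_of_ne_zero h0, hlog,
    show (ξ.arg : ℂ) * Complex.I * lam = ((lam * ξ.arg : ℝ) : ℂ) * Complex.I by push_cast; ring,
    Complex.sub_re, Complex.sub_re, Complex.exp_ofReal_mul_I_re] at hre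
  simp only [Complex.one_re, Complex.mul_re, Complex.ofReal_re, Complex.I_re, mul_zero,
    Complex.ofReal_im, zero_mul, sub_zero, Complex.I_im, sub_self] at hre
  have habs : |lam * ξ.arg| < 2 * Real.pi := by
    rw [abs_mul, abs_of_pos hlam]
    exact (mul_lt_mul_of_pos_left harg hlam).trans hlθ
  rw [abs_lt] at habs
  have h2 := (Real.cos_eq_one_iff_of_lt_of_lt habs.1 habs.2).1 (by linarith)
  have h3 : ξ.arg = 0 := (mul_eq_zero.1 h2).resolve_left hlam.ne'
  rw [← Complex.norm_mul_exp_arg_mul_I ξ, hn, h3]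
  simp

theorem one_sub_cpow_ne_zero {lam : ℝ} (hlam : 0 < lam) {ξ : ℂ} (hξ : ‖ξ‖ < 1) :
    1 - ξ ^ (lam : ℂ) ≠ 0 := by
  intro h
  rw [sub_eq_zero] at h
  have h1 := congrArg norm h
  rw [norm_one, Complex.norm_cpow_real] at h1
  exact (Real.rpow_lt_one (norm_nonneg _) hξ hlam).ne' h1

/-- This derivative is the source of the factor 1 - ξ^lam in the scalings. -/
theorem hasDerivAt_log_sub_cpow {lam : ℝ} (hlam : 0 < lam) {ξ : ℂ} (hξ : ξ ∈ Complex.slitPlane) :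
    HasDerivAt (fun x : ℂ => Complex.log x - x ^ (lam : ℂ) / lam) ((1 - ξ ^ (lam : ℂ)) / ξ) ξ := by
  have hlc : (lam : ℂ) ≠ 0 := by exact_mod_cast hlam.ne'
  have h0 := Complex.slitPlane_ne_zero hξ
  have h1 := (Complex.hasDerivAt_log hξ).sub
    (((hasDerivAt_id ξ).cpow_const (c := (lam : ℂ)) hξ).div_const (lam : ℂ))
  convert! h1 using 1
  rw [id, Complex.cpow_sub _ _ h0, Complex.cpow_one]
  field_simp

/-- The expansion of `n * log z - n * z ^ lam / lam` near `ξ`. -/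
theorem tendsto_exponent {ι : Type*} {l : Filter ι} {n : ι → ℕ} {ε : ι → ℂ}
    (hε0 : Tendsto ε l (𝓝 0)) (hε : Tendsto (fun q => (n q : ℂ) * ε q ^ 2) l (𝓝 0)) {lam : ℝ}
    (hlam : 0 < lam) {ξ : ℂ} (hξ : ξ ∈ Complex.slitPlane) :
    Tendsto (fun q => (n q : ℂ) * (Complex.log (ξ * (1 + ε q))
        - (ξ * (1 + ε q)) ^ (lam : ℂ) / lam - (Complex.log ξ - ξ ^ (lam : ℂ) / lam)
        - ε q * (1 - ξ ^ (lam : ℂ)))) l (𝓝 0) := by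
  have h0 := Complex.slitPlane_ne_zero hξ
  have han : AnalyticAt ℂ (fun x : ℂ => Complex.log x - x ^ (lam : ℂ) / lam) ξ := by
    refine DifferentiableOn.analyticAt (s := Complex.slitPlane) (fun x hx => ?_)
      (Complex.isOpen_slitPlane.mem_nhds hξ)
    exact (hasDerivAt_log_sub_cpow hlam hx).differentiableAt.differentiableWithinAt
  have hO := isBigO_sub_sub_deriv han
  rw [(hasDerivAt_log_sub_cpow hlam hξ).deriv] at hO
  have hy : Tendsto (fun q => ξ * ε q) l (𝓝 0) := by simpa using hε0.const_mul ξ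
  have h1 := (isBigO_refl (fun q => (n q : ℂ)) l).mul (hO.comp_tendsto hy)
  have h2 : Tendsto (fun q => (n q : ℂ) * (ξ * ε q) ^ 2) l (𝓝 0) := by
    have := hε.const_mul (ξ ^ 2)
    rw [mul_zero] at this
    refine this.congr fun q => ?_
    ring
  refine (h1.trans_tendsto h2).congr fun q => ?_
  simp only [Function.comp_apply]
  rw [show ξ + ξ * ε q = ξ * (1 + ε q) by ring]
  field_simp

/-- Up to factors tending to 1 and the power z^{-a}, the quotient is exp(n(log z - z^lam/lam +
1/lam)). The last exponential in the statement removes the value -iτn/lam at ξ and the linear term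
in ε; the quadratic remainder is O(nε²). -/
theorem tendsto_prefactor {ι : Type*} {l : Filter ι} {n : ι → ℕ} (hn : Tendsto n l atTop)
    {ε : ι → ℂ} (hε0 : Tendsto ε l (𝓝 0)) (hε : Tendsto (fun q => (n q : ℂ) * ε q ^ 2) l (𝓝 0))
    {f : ℂ → ℂ} {lam θ : ℝ} (hlam : 0 < lam) (hθπ : θ < Real.pi) {ξ a : ℂ}
    (hξ : ξ ∈ limitCurve lam) (harg : |ξ.arg| < θ)
    (hgrowth : f ~[Bornology.cobounded ℂ ⊓ 𝓟 (sector 1 θ)]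
      fun z => z ^ a * Complex.exp (z ^ (lam : ℂ))) :
    (∀ᶠ q in l, f (scaleRadius lam (n q) * (ξ * (1 + ε q))) ≠ 0) ∧
    Tendsto (fun q => (scaleRadius lam (n q) : ℂ) ^ a * Complex.exp (n q / lam)
        * (ξ * (1 + ε q)) ^ n q / f (scaleRadius lam (n q) * (ξ * (1 + ε q)))
        * Complex.exp (-(n q * ε q * (1 - ξ ^ (lam : ℂ)) - Complex.I * (tau lam ξ * n q / lam : ℝ))))
      l (𝓝 (ξ ^ (-a))) := by
  have hlc : (lam : ℂ) ≠ 0 := by exact_mod_cast hlam.ne'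
  have h0 := limitCurve_ne_zero hlam hξ
  have hslit : ξ ∈ Complex.slitPlane := by
    rw [Complex.mem_slitPlane_iff_arg]
    refine ⟨fun h => ?_, h0⟩
    rw [h, abs_of_pos Real.pi_pos] at harg
    linarith
  have hz : Tendsto (fun q => ξ * (1 + ε q)) l (𝓝 ξ) := by
    simpa using (hε0.const_add 1).const_mul ξ
  have hexp := (tendsto_exponent hε0 hε hlam hslit).cexp
  rw [Complex.exp_zero] at hexp
  have hz0 : ∀ᶠ q in l, ξ * (1 + ε q) ≠ 0 := hz.eventually_ne h0
  have hzarg : ∀ᶠ q in l, |(ξ * (1 + ε q)).arg| ≤ θ :=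
    ((Complex.continuousAt_arg hslit).tendsto.comp hz).abs.eventually_le_const harg
  have hpow : Tendsto (fun q => (ξ * (1 + ε q)) ^ (-a)) l (𝓝 (ξ ^ (-a))) :=
    (continuousAt_cpow_const hslit).tendsto.comp hz
  have hr : ∀ᶠ q in l, 0 < scaleRadius lam (n q) :=
    hn.eventually ((tendsto_scaleRadius hlam).eventually_gt_atTop 0)
  have hτ : ξ ^ (lam : ℂ) - 1 - lam * Complex.log ξ = tau lam ξ * Complex.I := by
    conv_lhs => rw [← Complex.re_add_im (ξ ^ (lam : ℂ) - 1 - lam * Complex.log ξ),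
      limitCurve_re hlam hξ]
    simp [tau]
  generalize hZ : (fun q => ξ * (1 + ε q)) = z at *
  have hZ' : ∀ q, ξ * (1 + ε q) = z q := fun q => congrFun hZ q
  simp only [hZ'] at hexp hz0 hzarg hpow ⊢
  have hlarge : Tendsto (fun q => (scaleRadius lam (n q) : ℂ) * z q) l
      (Bornology.cobounded ℂ ⊓ 𝓟 (sector 1 θ)) := by
    rw [tendsto_inf, tendsto_principal]
    constructor
    · rw [← tendsto_norm_atTop_iff_cobounded]
      have := ((tendsto_scaleRadius hlam).comp hn).atTop_mul_pos (norm_pos_iff.2 h0) hz.norm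
      refine this.congr' ?_
      filter_upwards [hr] with q hq
      rw [norm_mul, Complex.norm_real, Real.norm_of_nonneg hq.le]
      rfl
    · filter_upwards [hr, hz0, hzarg] with q hq hq0 hqa
      rw [real_mul_mem_sector hq]
      exact ⟨hq0, by rwa [div_one]⟩
  obtain ⟨φ, hφ, hfφ⟩ := hgrowth.exists_eq_mul
  have hφz := hφ.comp hlarge
  have hfz := hlarge.eventually hfφ
  have hφ0 : ∀ᶠ q in l, φ (scaleRadius lam (n q) * z q) ≠ 0 := hφz.eventually_ne one_ne_zero
  constructor
  · filter_upwards [hfz, hφ0, hr, hz0] with q hq hq1 hq2 hq3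
    rw [hq]
    have hrc : (scaleRadius lam (n q) : ℂ) ≠ 0 := by exact_mod_cast hq2.ne'
    refine mul_ne_zero hq1 (mul_ne_zero ?_ (Complex.exp_ne_zero _))
    rw [Ne, Complex.cpow_eq_zero_iff]
    exact fun h => mul_ne_zero hrc hq3 h.1
  · have hlim := ((hφz.inv₀ one_ne_zero).mul hpow).mul hexp
    rw [inv_one, one_mul, mul_one] at hlim
    refine hlim.congr' ?_
    filter_upwards [hfz, hφ0, hr, hz0, hn.eventually_ne_atTop 0] with q hq hq1 hq2 hq3 hq4
    have hrc : (scaleRadius lam (n q) : ℂ) ≠ 0 := by exact_mod_cast hq2.ne'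
    have hra : (scaleRadius lam (n q) : ℂ) ^ a ≠ 0 := by simp [Complex.cpow_eq_zero_iff, hrc]
    have hza : z q ^ a ≠ 0 := by simp [Complex.cpow_eq_zero_iff, hq3]
    have hzn : z q ^ n q = Complex.exp (n q * Complex.log (z q)) := by
      rw [Complex.exp_nat_mul, Complex.exp_log hq3]
    have hE : Complex.exp (n q * (Complex.log (z q) - z q ^ (lam : ℂ) / lam
          - (Complex.log ξ - ξ ^ (lam : ℂ) / lam) - ε q * (1 - ξ ^ (lam : ℂ))))
        = Complex.exp (n q / lam) * Complex.exp (n q * Complex.log (z q))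
          * (Complex.exp (n q / lam * z q ^ (lam : ℂ)))⁻¹
          * Complex.exp (-(n q * ε q * (1 - ξ ^ (lam : ℂ))
            - Complex.I * (tau lam ξ * n q / lam : ℝ))) := by
      rw [← Complex.exp_neg, ← Complex.exp_add, ← Complex.exp_add, ← Complex.exp_add]
      congr 1
      push_cast
      rw [show Complex.I * (tau lam ξ * n q / lam) = n q / lam * (tau lam ξ * Complex.I) by ring,
        ← hτ]
      field_simp
      ring
    have hval : f (scaleRadius lam (n q) * z q) = φ (scaleRadius lam (n q) * z q)
        * ((scaleRadius lam (n q) : ℂ) ^ a * z q ^ a * Complex.exp (n q / lam * z q ^ (lam : ℂ))) := by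
      rw [hq, Pi.mul_apply, scaleRadius_mul_cpow hlam hq4 hq3, ofReal_mul_cpow hq2 hq3]
    rw [hval, hzn, hE]
    simp only [Function.comp_apply]
    rw [Complex.cpow_neg]
    have h5 := Complex.exp_ne_zero (n q / lam * z q ^ (lam : ℂ))
    field_simp

/-! ### Collecting the directions -/

theorem norm_pow_mul_cpow {ω ζ : ℂ} (hω : ‖ω‖ = 1) (hζ : ‖ζ‖ = 1) {r : ℝ} (hr : 0 < r) (c : ℂ)
    (n : ℕ) : ‖(ω / ζ) ^ n * (r : ℂ) ^ c‖ = r ^ c.re := by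
  rw [norm_mul, norm_pow, norm_div, hω, hζ, Complex.norm_cpow_eq_rpow_re_of_pos hr]
  simp

section remainder

variable {ι : Type*} {l : Filter ι} {n : ι → ℕ} {lam : ℝ} {ω ζ : ℂ}

/-- With c = b k - β this is the size of direction k relative to the reference ω, β: bounded for the
directions kept, while `tendsto_pow_mul_cpow` disposes of the others. -/
theorem isBigO_pow_mul_cpow (hn : Tendsto n l atTop) (hlam : 0 < lam) (hω : ‖ω‖ = 1)
    (hζ : ‖ζ‖ = 1) {c : ℂ} (hc : c.re ≤ 0) :
    (fun q => (ω / ζ) ^ n q * (scaleRadius lam (n q) : ℂ) ^ c) =O[l] fun _ => (1 : ℝ) := by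
  refine IsBigO.of_bound 1 ?_
  filter_upwards [hn.eventually ((tendsto_scaleRadius hlam).eventually_ge_atTop 1)] with q hq
  rw [norm_pow_mul_cpow hω hζ (by linarith)]
  simpa using Real.rpow_le_one_of_one_le_of_nonpos hq hc

theorem tendsto_pow_mul_cpow (hn : Tendsto n l atTop) (hlam : 0 < lam) (hω : ‖ω‖ = 1)
    (hζ : ‖ζ‖ = 1) {c : ℂ} (hc : c.re < 0) :
    Tendsto (fun q => (ω / ζ) ^ n q * (scaleRadius lam (n q) : ℂ) ^ c) l (𝓝 0) := by
  rw [tendsto_zero_iff_norm_tendsto_zero]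
  have h := (tendsto_rpow_neg_atTop (neg_pos.2 hc)).comp ((tendsto_scaleRadius hlam).comp hn)
  refine h.congr' ?_
  filter_upwards [hn.eventually ((tendsto_scaleRadius hlam).eventually_gt_atTop 0)] with q hq
  rw [norm_pow_mul_cpow hω hζ hq]
  simp

/-- The asymptotics of the normalised remainder integral. -/
theorem tendsto_remainder_integral [l.IsCountablyGenerated] (hn : Tendsto n l atTop) {z : ι → ℂ}
    {ξ : ℂ} (hz : Tendsto z l (𝓝 ξ)) (hξ : ‖ξ‖ < 1) {m : ℕ} {θ μ : ℝ} {b A ζ : Fin (m + 1) → ℂ}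
    {f : ℂ → ℂ} (H : HasMaximalGrowth m lam θ μ b A ζ f) (hω : ‖ω‖ = 1) {β : ℂ}
    {T : Finset (Fin (m + 1))} (hle : ∀ k, (b k).re ≤ β.re) (hlt : ∀ k ∉ T, (b k).re < β.re) :
    Tendsto (fun q => (√(n q : ℝ) : ℝ) * (ω ^ n q * (scaleRadius lam (n q) : ℂ) ^ (-β)
        * Complex.exp (-(n q / lam))) * (∫ t in (-Real.pi)..Real.pi,
          remainderKernel f (scaleRadius lam (n q)) (n q) (z q) (Complex.exp (t * Complex.I)))
        - ∑ k ∈ T, (ω / ζ k) ^ n q * (scaleRadius lam (n q) : ℂ) ^ (b k - β)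
          * (A k * ζ k / (ζ k - ξ) * (√(2 * Real.pi / lam) : ℝ))) l (𝓝 0) := by
  have hlam := H.lam_pos
  have hζ0 : ∀ k, ζ k ≠ 0 := by
    intro k h
    simpa [h] using H.norm_zeta k
  have hY := fun k => tendsto_sector_integral hn hz hξ H.entire.continuous hlam H.theta_pos
    H.theta_lt_pi H.lam_mul_theta_lt (H.norm_zeta k) (H.growth k)
  have hR := tendsto_integral_compl_sectors hn hz hξ hlam H.mu_lt_one H.small hω β
  have hterm : ∀ k, Tendsto (fun q => (ω / ζ k) ^ n q * (scaleRadius lam (n q) : ℂ) ^ (b k - β)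
        * ((√(n q : ℝ) : ℝ) * (ζ k ^ n q * (scaleRadius lam (n q) : ℂ) ^ (-b k)
        * Complex.exp (-(n q / lam))) * ∫ t in (-θ)..θ, remainderKernel f (scaleRadius lam (n q))
          (n q) (z q) (ζ k * Complex.exp (t * Complex.I)))
      - if k ∈ T then (ω / ζ k) ^ n q * (scaleRadius lam (n q) : ℂ) ^ (b k - β)
        * (A k * ζ k / (ζ k - ξ) * (√(2 * Real.pi / lam) : ℝ)) else 0) l (𝓝 0) := by
    intro k
    by_cases hk : k ∈ T
    · simp only [hk, if_true, ← mul_sub]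
      have h1 := isBigO_pow_mul_cpow hn hlam hω (H.norm_zeta k) (c := b k - β)
        (by simpa using hle k)
      have h2 := (isLittleO_one_iff ℝ).2 (tendsto_sub_nhds_zero_iff.2 (hY k))
      have h3 := h1.mul_isLittleO h2
      simp only [mul_one] at h3
      exact (isLittleO_one_iff ℝ).1 h3
    · simp only [hk, if_false, sub_zero]
      have h1 := tendsto_pow_mul_cpow hn hlam hω (H.norm_zeta k) (c := b k - β)
        (by simpa using hlt k hk)
      simpa using h1.mul (hY k)
  have hsum := (tendsto_finsetSum Finset.univ fun k _ => hterm k).add hR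
  simp only [Finset.sum_const_zero, add_zero] at hsum
  refine hsum.congr' ?_
  filter_upwards [hn.eventually_ne_atTop 0, hz.norm.eventually_lt_const hξ] with q hq hq1
  have hr := scaleRadius_pos hlam hq
  have hrc : (scaleRadius lam (n q) : ℂ) ≠ 0 := by exact_mod_cast hr.ne'
  rw [integral_circle_eq_sum_sectors H.norm_zeta H.theta_pos H.theta_lt_pi H.sectors_disjoint
    (continuous_remainderKernel H.entire.continuous _ _ hq1 (by fun_prop)
      Complex.norm_exp_ofReal_mul_I), Finset.sum_sub_distrib, mul_add, Finset.mul_sum,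
    Finset.sum_ite_mem, Finset.univ_inter, sub_add_eq_add_sub]
  congr 2
  refine Finset.sum_congr rfl fun k _ => ?_
  rw [← mul_assoc]
  congr 1
  have h1 : (scaleRadius lam (n q) : ℂ) ^ (-β)
      = (scaleRadius lam (n q) : ℂ) ^ (b k - β) * (scaleRadius lam (n q) : ℂ) ^ (-b k) := by
    rw [← Complex.cpow_add _ _ hrc]
    congr 1
    ring
  have h2 := pow_ne_zero (n q) (hζ0 k)
  rw [h1, div_pow]
  field_simp

end remainder

/-! ### The displacement from ξ -/

theorem abs_angleRep_le (x : ℝ) : |angleRep x| ≤ Real.pi := by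
  obtain ⟨⟨h1, h2⟩, -⟩ := (angleRep_eq_iff x _).1 rfl
  exact abs_le.2 ⟨h1.le, h2⟩

theorem exp_I_mul_angleRep (x : ℝ) :
    Complex.exp (Complex.I * angleRep x) = Complex.exp (Complex.I * x) := by
  obtain ⟨-, k, hk⟩ := (angleRep_eq_iff x _).1 rfl
  rw [eq_comm, Complex.exp_eq_exp_iff_exists_int]
  refine ⟨k, ?_⟩
  conv_lhs => rw [hk]
  push_cast
  ring

theorem exp_I_mul_sigmaSeq {ω : ℂ} (hω : ‖ω‖ = 1) (n : ℕ) :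
    Complex.exp (Complex.I * sigmaSeq ω n) = ω ^ n := by
  have h : ω = Complex.exp (ω.arg * Complex.I) := by
    conv_lhs => rw [← Complex.norm_mul_exp_arg_mul_I ω, hω]
    simp
  rw [sigmaSeq, exp_I_mul_angleRep]
  conv_rhs => rw [h, ← Complex.exp_nat_mul]
  congr 1
  push_cast
  ring

/-- The relative displacement of `scalingPointDir` from `ξ`. -/
noncomputable def displacement (lam : ℝ) (a β ω ξ : ℂ) (n : ℕ) (w : ℂ) : ℂ :=
  (a - β + lam / 2) * ((Real.log n : ℂ) / (lam * (1 - ξ ^ (lam : ℂ)) * n))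
    - (w - Complex.I * sigmaSeq ω n - Complex.I * tauSeq lam ξ n) / ((1 - ξ ^ (lam : ℂ)) * n)

theorem scalingPointDir_eq (lam : ℝ) (a β ω ξ : ℂ) (n : ℕ) (w : ℂ) :
    scalingPointDir lam a β ω ξ n w = ξ * (1 + displacement lam a β ω ξ n w) := by
  rw [scalingPointDir, displacement, add_sub_assoc]

/-- By design nε(1 - ξ^lam) = (a - β) log n / lam + (log n)/2 - w + iσ_n + iτ_n. Here n^{(a-β)/lam}
= r_n^{a-β} lam^{(a-β)/lam}, and iτ_n cancels the phase modulo 2πi. -/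
theorem exp_displacement {lam : ℝ} (hlam : 0 < lam) {ω ξ : ℂ} (hω : ‖ω‖ = 1) (hξ : ‖ξ‖ < 1)
    (a β : ℂ) {n : ℕ} (hn : n ≠ 0) (w : ℂ) :
    Complex.exp (n * displacement lam a β ω ξ n w * (1 - ξ ^ (lam : ℂ))
        - Complex.I * (tau lam ξ * n / lam : ℝ))
      = (scaleRadius lam n : ℂ) ^ (a - β) * (lam : ℂ) ^ ((a - β) / lam) * Complex.exp (-w)
        * (√(n : ℝ) : ℝ) * ω ^ n := by
  have hlc : (lam : ℂ) ≠ 0 := by exact_mod_cast hlam.ne'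
  have hnc : (n : ℂ) ≠ 0 := by exact_mod_cast hn
  have hn0 : (0 : ℝ) < n := by exact_mod_cast Nat.pos_of_ne_zero hn
  have hd := one_sub_cpow_ne_zero hlam hξ
  have hrpos := scaleRadius_pos hlam hn
  have hlogr : Complex.log (scaleRadius lam n) = (Real.log n - Real.log lam) / lam := by
    rw [← Complex.ofReal_log hrpos.le, scaleRadius, Real.log_rpow (by positivity),
      Real.log_div hn0.ne' hlam.ne']
    push_cast
    ring
  have hτ : Complex.exp (Complex.I * tauSeq lam ξ n)
      = Complex.exp (Complex.I * (tau lam ξ * n / lam : ℝ)) := exp_I_mul_angleRep _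
  have hsqrt : ((√(n : ℝ) : ℝ) : ℂ) = Complex.exp (Real.log n / 2) := by
    rw [Real.sqrt_eq_rpow, Real.rpow_def_of_pos hn0]
    push_cast
    congr 1
    ring
  have hE : n * displacement lam a β ω ξ n w * (1 - ξ ^ (lam : ℂ))
      = (a - β) * Real.log n / lam + Real.log n / 2 - w + Complex.I * sigmaSeq ω n
        + Complex.I * tauSeq lam ξ n := by
    rw [displacement]
    field_simp
    ring
  rw [hE, Complex.exp_sub, Complex.exp_add _ (Complex.I * tauSeq lam ξ n), hτ,
    mul_div_cancel_right₀ _ (Complex.exp_ne_zero _), Complex.exp_add, exp_I_mul_sigmaSeq hω, hsqrt,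
    Complex.cpow_def_of_ne_zero (by exact_mod_cast hrpos.ne'), Complex.cpow_def_of_ne_zero hlc,
    hlogr, ← Complex.ofReal_log hlam.le, ← Complex.exp_add, ← Complex.exp_add, ← Complex.exp_add]
  congr 2
  field_simp
  ring

/-- Since σ_n and τ_n are reduced modulo 2π they stay bounded, so ε = O(log n / n). The gain of √n
yields the condition nε² → 0. -/
theorem tendsto_sqrt_mul_displacement {ι : Type*} {l : Filter ι} {n : ι → ℕ}
    (hn : Tendsto n l atTop) {w : ι → ℂ} (hw : w =O[l] fun _ => (1 : ℝ)) {lam : ℝ}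
    (hlam : 0 < lam) {ξ : ℂ} (hξ : ‖ξ‖ < 1) (a β ω : ℂ) :
    Tendsto (fun q => ((√(n q : ℝ) : ℝ) : ℂ) * displacement lam a β ω ξ (n q) (w q)) l (𝓝 0) := by
  have hlc : (lam : ℂ) ≠ 0 := by exact_mod_cast hlam.ne'
  have hd := one_sub_cpow_ne_zero hlam hξ
  have hlog : Tendsto (fun q => Real.log (n q) / √(n q : ℝ)) l (𝓝 0) := by
    have h := (isLittleO_log_rpow_atTop (r := 1 / 2) (by norm_num)).tendsto_div_nhds_zero
    simp_rw [← Real.sqrt_eq_rpow] at h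
    exact (h.comp tendsto_natCast_atTop_atTop).comp hn
  have hangle : ∀ x : ι → ℝ, (fun q => Complex.I * (angleRep (x q) : ℂ)) =O[l] fun _ => (1 : ℝ) := by
    intro x
    refine IsBigO.of_bound Real.pi (Eventually.of_forall fun q => ?_)
    simpa using abs_angleRep_le (x q)
  have hV : (fun q => (w q - Complex.I * sigmaSeq ω (n q) - Complex.I * tauSeq lam ξ (n q)))
      =O[l] fun _ => (1 : ℝ) := (hw.sub (hangle _)).sub (hangle _)
  have hinv : Tendsto (fun q => (((√(n q : ℝ))⁻¹ : ℝ) : ℂ)) l (𝓝 0) := by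
    have := (Complex.continuous_ofReal.tendsto 0).comp (tendsto_natCast_inv_sqrt hn)
    simpa only [Complex.ofReal_zero, Function.comp_def] using this
  have h2 := hV.mul_isLittleO ((isLittleO_one_iff ℝ).2 hinv)
  simp only [mul_one] at h2
  have h3 := ((isLittleO_one_iff ℝ).1 h2).const_mul ((1 - ξ ^ (lam : ℂ))⁻¹)
  have h1 : Tendsto (fun q => ((Real.log (n q) / √(n q : ℝ) : ℝ) : ℂ)) l (𝓝 0) := by
    have := (Complex.continuous_ofReal.tendsto 0).comp hlog
    simpa only [Complex.ofReal_zero, Function.comp_def] using this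
  have h4 := (h1.const_mul ((a - β + lam / 2) / (lam * (1 - ξ ^ (lam : ℂ))))).sub h3
  rw [mul_zero, mul_zero, sub_zero] at h4
  refine h4.congr' ?_
  filter_upwards [hn.eventually_ne_atTop 0] with q hq
  have hsq := ofReal_sqrt_natCast_mul_self (n q)
  have hne : ((√(n q : ℝ) : ℝ) : ℂ) ≠ 0 := by
    intro h
    rw [h, zero_mul] at hsq
    exact hq (by exact_mod_cast hsq.symm)
  rw [displacement, ← hsq]
  push_cast
  field_simp

/-! ### The general asymptotic formula -/

/-- T must contain every direction whose exponent has real part Re β. Uniformity on K is handled as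
a limit along `atTop ×ˢ 𝓟 K`, so each earlier limit applies to the pair (n, w). -/
theorem quotientAsymp_scalingPointDir {m : ℕ} {lam θ μ : ℝ} {b A ζ : Fin (m + 1) → ℂ} {f : ℂ → ℂ}
    (H : HasMaximalGrowth m lam θ μ b A ζ f) {ξ : ℂ} (hξ : ξ ∈ limitCurve lam)
    (harg : |ξ.arg| < θ) (hξ1 : ξ ≠ 1) {β ω : ℂ} (hω : ‖ω‖ = 1) {T : Finset (Fin (m + 1))}
    (hle : ∀ k, (b k).re ≤ β.re) (hlt : ∀ k ∉ T, (b k).re < β.re) :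
    QuotientAsymp f lam (scalingPointDir lam (b 0) β ω ξ) (fun n w =>
      1 - (∑ k ∈ T, A k * ζ k ^ (1 - (n : ℤ)) * ω ^ n * (scaleRadius lam n : ℂ) ^ (b k - β)
          / (ζ k - ξ))
        * ((lam : ℂ) ^ ((b 0 - β) / lam) * Complex.exp (-w)
          / (ξ ^ b 0 * (√(2 * Real.pi * lam) : ℝ)))) := by
  intro K hK
  have hlam := H.lam_pos
  have hnorm := limitCurve_norm_lt_one hlam H.lam_mul_theta_lt hξ harg hξ1
  have hξ0 := limitCurve_ne_zero hlam hξ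
  have hζ0 : ∀ k, ζ k ≠ 0 := by
    intro k h
    simpa [h] using H.norm_zeta k
  have hζξ : ∀ k, ζ k - ξ ≠ 0 := by
    intro k h
    rw [sub_eq_zero] at h
    rw [← h, H.norm_zeta] at hnorm
    exact lt_irrefl _ hnorm
  have hn : Tendsto (Prod.fst : ℕ × ℂ → ℕ) (atTop ×ˢ 𝓟 K) atTop := tendsto_fst
  obtain ⟨M, hM⟩ := hK.isBounded.exists_norm_le
  have hK' : ∀ᶠ q : ℕ × ℂ in atTop ×ˢ 𝓟 K, ‖q.2‖ ≤ M :=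
    tendsto_snd.eventually (eventually_principal.2 hM)
  have hw : (fun q : ℕ × ℂ => q.2) =O[atTop ×ˢ 𝓟 K] fun _ => (1 : ℝ) :=
    IsBigO.of_bound M (by simpa using hK')
  have hexpw : (fun q : ℕ × ℂ => Complex.exp (-q.2)) =O[atTop ×ˢ 𝓟 K] fun _ => (1 : ℝ) := by
    refine IsBigO.of_bound (Real.exp M) ?_
    filter_upwards [hK'] with q hq
    rw [norm_one, mul_one]
    refine (Complex.norm_exp_le_exp_norm _).trans (Real.exp_le_exp.2 ?_)
    rwa [norm_neg]
  set ε : ℕ × ℂ → ℂ := fun q => displacement lam (b 0) β ω ξ q.1 q.2 with hεdef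
  have hsqrt := tendsto_sqrt_mul_displacement hn hw hlam hnorm (b 0) β ω
  have hε : Tendsto (fun q => (q.1 : ℂ) * ε q ^ 2) (atTop ×ˢ 𝓟 K) (𝓝 0) := by
    have h := hsqrt.mul hsqrt
    rw [mul_zero] at h
    refine h.congr fun q => ?_
    rw [← ofReal_sqrt_natCast_mul_self]
    ring
  have hε0 : Tendsto ε (atTop ×ˢ 𝓟 K) (𝓝 0) := by
    have hinv := (Complex.continuous_ofReal.tendsto 0).comp (tendsto_natCast_inv_sqrt hn)
    rw [Complex.ofReal_zero] at hinv
    have h := hinv.mul hsqrt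
    rw [mul_zero] at h
    refine h.congr' ?_
    filter_upwards [hn.eventually_ne_atTop 0] with q hq
    have hne : ((√(q.1 : ℝ) : ℝ) : ℂ) ≠ 0 := by
      rw [Complex.ofReal_ne_zero, Real.sqrt_ne_zero']
      exact_mod_cast Nat.pos_of_ne_zero hq
    rw [Function.comp_apply, Complex.ofReal_inv, inv_mul_cancel_left₀ hne]
  have hz : Tendsto (fun q => ξ * (1 + ε q)) (atTop ×ˢ 𝓟 K) (𝓝 ξ) := by
    simpa using (hε0.const_add 1).const_mul ξ
  have hgrowth : f ~[Bornology.cobounded ℂ ⊓ 𝓟 (sector 1 θ)]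
      fun z => z ^ b 0 * Complex.exp (z ^ (lam : ℂ)) := by
    simpa [H.zeta_zero, H.A_zero] using H.growth 0
  obtain ⟨hne, hD⟩ := tendsto_prefactor hn hε0 hε hlam H.theta_lt_pi hξ harg hgrowth
  have hX := tendsto_remainder_integral hn hz hnorm H hω hle hlt
  have hS : (fun q : ℕ × ℂ => ∑ k ∈ T, (ω / ζ k) ^ q.1 * (scaleRadius lam q.1 : ℂ) ^ (b k - β)
      * (A k * ζ k / (ζ k - ξ) * (√(2 * Real.pi / lam) : ℝ))) =O[atTop ×ˢ 𝓟 K]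
        fun _ => (1 : ℝ) := by
    refine IsBigO.fun_sum fun k _ => ?_
    have h := (isBigO_pow_mul_cpow hn hlam hω (H.norm_zeta k) (c := b k - β)
      (by simpa using hle k)).mul (isBigO_const_const
        (A k * ζ k / (ζ k - ξ) * (√(2 * Real.pi / lam) : ℝ) : ℂ) (one_ne_zero (α := ℝ))
        (atTop ×ˢ 𝓟 K))
    simpa only [mul_one] using h
  -- With D → D₀ the prefactor, X the normalised integral and S its main sum, DX - D₀S = D(X - S) +
  -- (D - D₀)S; D and S are bounded, and so is e^{-w} on K.
  have h1 := (hD.isBigO_one ℝ).mul_isLittleO ((isLittleO_one_iff ℝ).2 hX)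
  have h2 := ((isLittleO_one_iff ℝ).2 (tendsto_sub_nhds_zero_iff.2 hD)).mul_isBigO hS
  have h3 := hexpw.mul_isLittleO (h1.add h2)
  simp only [mul_one] at h3
  have h4 := ((isLittleO_one_iff ℝ).1 h3).const_mul
    (-((2 * Real.pi : ℂ)⁻¹ * (lam : ℂ) ^ ((b 0 - β) / lam)))
  rw [mul_zero] at h4
  refine ⟨?_, ?_⟩
  · have := eventually_prod_principal_iff.1 hne
    simpa only [scalingPointDir_eq] using this
  rw [Metric.tendstoUniformlyOn_iff]
  intro η hη
  have hlim : Tendsto (fun q : ℕ × ℂ =>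
      partialSum f (q.1 - 1) (scaleRadius lam q.1 * scalingPointDir lam (b 0) β ω ξ q.1 q.2)
        / f (scaleRadius lam q.1 * scalingPointDir lam (b 0) β ω ξ q.1 q.2)
      - (1 - (∑ k ∈ T, A k * ζ k ^ (1 - (q.1 : ℤ)) * ω ^ q.1
          * (scaleRadius lam q.1 : ℂ) ^ (b k - β) / (ζ k - ξ))
        * ((lam : ℂ) ^ ((b 0 - β) / lam) * Complex.exp (-q.2)
          / (ξ ^ b 0 * (√(2 * Real.pi * lam) : ℝ))))) (atTop ×ˢ 𝓟 K) (𝓝 0) := by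
    refine h4.congr' ?_
    filter_upwards [hne, hn.eventually_ne_atTop 0, hz.norm.eventually_lt_const hnorm]
      with q hq hq0 hq1
    have hr := scaleRadius_pos hlam hq0
    have hrc : (scaleRadius lam q.1 : ℂ) ≠ 0 := by exact_mod_cast hr.ne'
    have hlc : (lam : ℂ) ≠ 0 := by exact_mod_cast hlam.ne'
    have hpart := sub_partialSum_eq H.entire hq0 hr hq1
    rw [show scalingPointDir lam (b 0) β ω ξ q.1 q.2 = ξ * (1 + ε q) from scalingPointDir_eq ..]
    have hexpE : Complex.exp (q.1 * ε q * (1 - ξ ^ (lam : ℂ))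
        - Complex.I * (tau lam ξ * q.1 / lam : ℝ)) = _ :=
      exp_displacement hlam hω hnorm (b 0) β hq0 q.2
    have hsum : ∑ k ∈ T, A k * ζ k ^ (1 - (q.1 : ℤ)) * ω ^ q.1
          * (scaleRadius lam q.1 : ℂ) ^ (b k - β) / (ζ k - ξ)
        = (∑ k ∈ T, (ω / ζ k) ^ q.1 * (scaleRadius lam q.1 : ℂ) ^ (b k - β)
          * (A k * ζ k / (ζ k - ξ) * (√(2 * Real.pi / lam) : ℝ)))
            * ((√(2 * Real.pi / lam) : ℝ) : ℂ)⁻¹ := by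
      rw [Finset.sum_mul]
      refine Finset.sum_congr rfl fun k _ => ?_
      have h5 : ((√(2 * Real.pi / lam) : ℝ) : ℂ) ≠ 0 := by
        rw [Complex.ofReal_ne_zero, Real.sqrt_ne_zero']
        positivity
      have h6 := hζ0 k
      have h7 := hζξ k
      rw [zpow_sub₀ h6, zpow_one, zpow_natCast, div_pow]
      field_simp
    -- Cauchy's 1/(2π) times the Gaussian's √(2π/lam) is 1/√(2π lam).
    have hconst : ((√(2 * Real.pi / lam) : ℝ) : ℂ)⁻¹ * ((√(2 * Real.pi * lam) : ℝ) : ℂ)⁻¹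
        = (2 * Real.pi : ℂ)⁻¹ := by
      rw [← mul_inv, ← Complex.ofReal_mul, ← Real.sqrt_mul (by positivity),
        show 2 * Real.pi / lam * (2 * Real.pi * lam) = (2 * Real.pi) ^ 2 by field_simp,
        Real.sqrt_sq (by positivity)]
      push_cast
      rfl
    have hquot : partialSum f (q.1 - 1) (scaleRadius lam q.1 * (ξ * (1 + ε q)))
        / f (scaleRadius lam q.1 * (ξ * (1 + ε q)))
        = 1 - (ξ * (1 + ε q)) ^ q.1 * ((2 * Real.pi : ℂ)⁻¹ * ∫ t in (-Real.pi)..Real.pi,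
          remainderKernel f (scaleRadius lam q.1) q.1 (ξ * (1 + ε q))
            (Complex.exp (t * Complex.I))) / f (scaleRadius lam q.1 * (ξ * (1 + ε q))) := by
      rw [← hpart, sub_div, div_self hq, sub_sub_cancel]
    have hs1 : ((√(2 * Real.pi / lam) : ℝ) : ℂ) ≠ 0 := by
      rw [Complex.ofReal_ne_zero, Real.sqrt_ne_zero']
      positivity
    have hs2 : ((√(2 * Real.pi * lam) : ℝ) : ℂ) ≠ 0 := by
      rw [Complex.ofReal_ne_zero, Real.sqrt_ne_zero']
      positivity
    have hs3 : ((√(q.1 : ℝ) : ℝ) : ℂ) ≠ 0 := by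
      rw [Complex.ofReal_ne_zero, Real.sqrt_ne_zero']
      exact_mod_cast Nat.pos_of_ne_zero hq0
    have hω0 : ω ^ q.1 ≠ 0 := by
      refine pow_ne_zero _ ?_
      rintro rfl
      simp at hω
    have hcpow : ∀ {x : ℂ} (c : ℂ), x ≠ 0 → x ^ c ≠ 0 := fun c hx => by
      simp [Complex.cpow_eq_zero_iff, hx]
    have ha := hcpow (b 0) hrc
    have hb := hcpow β hrc
    have hx := hcpow (b 0) hξ0
    have hl := hcpow ((b 0 - β) / lam) hlc
    have he := Complex.exp_ne_zero (q.1 / lam)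
    have hwq := Complex.exp_ne_zero (-q.2)
    rw [hsum, hquot, Complex.exp_neg (_ - _), hexpE, Complex.cpow_sub _ _ hrc, Complex.cpow_neg,
      Complex.cpow_neg ξ, Complex.exp_neg (_ / _), ← hconst]
    -- With the analytic expressions replaced by nonzero atoms where needed, a purely algebraic
    -- identity remains.
    generalize (∑ k ∈ T, (ω / ζ k) ^ q.1 * (scaleRadius lam q.1 : ℂ) ^ (b k - β)
      * (A k * ζ k / (ζ k - ξ) * (√(2 * Real.pi / lam) : ℝ))) = S
    generalize (∫ t in (-Real.pi)..Real.pi, remainderKernel f (scaleRadius lam q.1) q.1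
      (ξ * (1 + ε q)) (Complex.exp (t * Complex.I))) = J
    generalize f (scaleRadius lam q.1 * (ξ * (1 + ε q))) = F at hq
    generalize (ξ * (1 + ε q)) ^ q.1 = Z
    generalize (scaleRadius lam q.1 : ℂ) ^ b 0 = r₁ at ha
    generalize (scaleRadius lam q.1 : ℂ) ^ β = r₂ at hb
    generalize (lam : ℂ) ^ ((b 0 - β) / lam) = c at hl
    generalize ω ^ q.1 = W at hω0
    generalize ξ ^ b 0 = x at hx
    generalize Complex.exp (q.1 / lam) = e at he
    generalize Complex.exp (-q.2) = v at hwq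
    generalize ((√(2 * Real.pi / lam) : ℝ) : ℂ) = s₁ at hs1
    generalize ((√(2 * Real.pi * lam) : ℝ) : ℂ) = s₂ at hs2
    generalize ((√(q.1 : ℝ) : ℝ) : ℂ) = s₃ at hs3
    field_simp
    ring
  filter_upwards [eventually_prod_principal_iff.1 (hlim.norm.eventually_lt_const
    (by simpa using hη))] with n hn' w hwK
  rw [dist_zero_left]
  exact hn' w hwK

/-! ### The four cases -/

theorem QuotientAsymp.congr {f : ℂ → ℂ} {lam : ℝ} {z L L' : ℕ → ℂ → ℂ}
    (h : QuotientAsymp f lam z L) (hL : ∀ n w, L n w = L' n w) : QuotientAsymp f lam z L' := by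
  rwa [show L' = L from funext fun n => funext fun w => (hL n w).symm]

/-- For ω = 1 the angles σ_n vanish, and for β = a the coefficient (lam/2)/lam is 1/2. -/
theorem scalingPoint_eq_dir {lam : ℝ} (hlam : 0 < lam) (a ξ : ℂ) :
    scalingPoint lam ξ = scalingPointDir lam a a 1 ξ := by
  have hlc : (lam : ℂ) ≠ 0 := by exact_mod_cast hlam.ne'
  have h0 : sigmaSeq 1 = fun _ => 0 := by
    ext n
    rw [sigmaSeq, angleRep_eq_iff]
    exact ⟨⟨by linarith [Real.pi_pos], Real.pi_pos.le⟩, 0, by simp⟩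
  ext n w
  rw [scalingPoint, scalingPointDir, h0]
  congr 3
  · rw [sub_self, zero_add, ← mul_div_assoc, mul_assoc (lam : ℂ), mul_assoc (2 : ℂ)]
    field_simp
  · simp

end PartialSumScaling

theorem mainTheorem8 :
    -- one direction strictly dominates: a genuine scaling limit
    (∀ (m : ℕ) (_ : 1 ≤ m) (lam θ μ : ℝ) (b A ζ : Fin (m + 1) → ℂ) (f : ℂ → ℂ)
      (_ : PartialSumScaling.HasMaximalGrowth m lam θ μ b A ζ f)
      (j : Fin (m + 1)) (_ : ∀ k, k ≠ j → (b k).re < (b j).re)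
      (ξ : ℂ) (_ : ξ ∈ PartialSumScaling.limitCurve lam) (_ : |Complex.arg ξ| < θ) (_ : ξ ≠ 1),
      PartialSumScaling.QuotientAsymp f lam
        (PartialSumScaling.scalingPointDir lam (b 0) (b j) (ζ j) ξ)
        (fun _ w => 1 - A j * ζ j * (lam : ℂ) ^ ((b 0 - b j) / lam) * Complex.exp (-w)
          / (ξ ^ (b 0) * (ζ j - ξ) * (Real.sqrt (2 * Real.pi * lam) : ℂ)))) ∧
    -- the ties for three directions `1, ζ 1, ζ 2`
    (∀ (lam θ μ : ℝ) (b A ζ : Fin (2 + 1) → ℂ) (f : ℂ → ℂ)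
      (_ : PartialSumScaling.HasMaximalGrowth 2 lam θ μ b A ζ f)
      (ξ : ℂ) (_ : ξ ∈ PartialSumScaling.limitCurve lam) (_ : |Complex.arg ξ| < θ) (_ : ξ ≠ 1),
      ((b 0).re = (b 1).re → (b 2).re < (b 1).re →
        PartialSumScaling.QuotientAsymp f lam
          (PartialSumScaling.scalingPoint lam ξ)
          (fun n w => 1 - (1 / (1 - ξ)
              + A 1 * ζ 1 ^ (1 - (n : ℤ)) * (PartialSumScaling.scaleRadius lam n : ℂ) ^ (b 1 - b 0)
                / (ζ 1 - ξ))
            * (Complex.exp (-w) / (ξ ^ (b 0) * (Real.sqrt (2 * Real.pi * lam) : ℂ))))) ∧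
      ((b 0).re = (b 1).re → (b 1).re = (b 2).re →
        PartialSumScaling.QuotientAsymp f lam
          (PartialSumScaling.scalingPoint lam ξ)
          (fun n w => 1 - (1 / (1 - ξ)
              + A 1 * ζ 1 ^ (1 - (n : ℤ)) * (PartialSumScaling.scaleRadius lam n : ℂ) ^ (b 1 - b 0)
                / (ζ 1 - ξ)
              + A 2 * ζ 2 ^ (1 - (n : ℤ)) * (PartialSumScaling.scaleRadius lam n : ℂ) ^ (b 2 - b 0)
                / (ζ 2 - ξ))
            * (Complex.exp (-w) / (ξ ^ (b 0) * (Real.sqrt (2 * Real.pi * lam) : ℂ))))) ∧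
      ((b 1).re = (b 2).re → (b 0).re < (b 1).re →
        PartialSumScaling.QuotientAsymp f lam
          (PartialSumScaling.scalingPointDir lam (b 0) (b 1) (ζ 1) ξ)
          (fun n w => 1 - (A 1 / (ζ 1 - ξ)
              + A 2 * (ζ 2 / ζ 1) ^ (1 - (n : ℤ))
                * (PartialSumScaling.scaleRadius lam n : ℂ) ^ (b 2 - b 1) / (ζ 2 - ξ))
            * (ζ 1 * (lam : ℂ) ^ ((b 0 - b 1) / lam) * Complex.exp (-w)
              / (ξ ^ (b 0) * (Real.sqrt (2 * Real.pi * lam) : ℂ)))))) := by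
  refine ⟨?_, ?_⟩
  · intro m _ lam θ μ b A ζ f H j hj ξ hξ harg hξ1
    have hle : ∀ k, (b k).re ≤ (b j).re := fun k => by
      rcases eq_or_ne k j with rfl | hk
      · exact le_rfl
      · exact (hj k hk).le
    have hζ0 : ζ j ≠ 0 := fun h => by simpa [h] using H.norm_zeta j
    refine (PartialSumScaling.quotientAsymp_scalingPointDir H hξ harg hξ1 (H.norm_zeta j) (T := {j}) hle
      fun k hk => hj k (by simpa using hk)).congr fun n w => ?_
    -- With ω = ζ j and β = b j, the rotation and the power of r_n cancel in the only term, hence a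
    -- genuine limit.
    rw [Finset.sum_singleton, sub_self, Complex.cpow_zero, zpow_sub₀ hζ0, zpow_one, zpow_natCast]
    have hζn := pow_ne_zero n hζ0
    rw [mul_assoc (A j), div_mul_cancel₀ _ hζn]
    simp only [div_eq_mul_inv, mul_inv]
    ring
  · intro lam θ μ b A ζ f H ξ hξ harg hξ1
    have hA := H.A_zero
    have hζ := H.zeta_zero
    refine ⟨fun h01 h21 => ?_, fun h01 h12 => ?_, fun h12 h01 => ?_⟩
    · rw [PartialSumScaling.scalingPoint_eq_dir H.lam_pos (b 0)]
      refine (PartialSumScaling.quotientAsymp_scalingPointDir H hξ harg hξ1 norm_one (T := {0, 1}) ?_ ?_).congr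
        fun n w => ?_
      · intro k
        fin_cases k
        · exact le_rfl
        · exact h01.ge
        · exact (h21.trans_eq h01.symm).le
      · intro k hk
        fin_cases k
        · simp at hk
        · simp at hk
        · exact h21.trans_eq h01.symm
      · rw [Finset.sum_pair (by decide), hA, hζ]
        simp
    · rw [PartialSumScaling.scalingPoint_eq_dir H.lam_pos (b 0)]
      refine (PartialSumScaling.quotientAsymp_scalingPointDir H hξ harg hξ1 norm_one (T := Finset.univ) ?_ ?_).congr
        fun n w => ?_
      · intro k
        fin_cases k
        · exact le_rfl
        · exact h01.ge
        · exact (h01.trans h12).ge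
      · intro k hk
        exact absurd (Finset.mem_univ k) hk
      · rw [Fin.sum_univ_three, hA, hζ]
        simp
    · have hζ0 : ζ 1 ≠ 0 := fun h => by simpa [h] using H.norm_zeta 1
      refine (PartialSumScaling.quotientAsymp_scalingPointDir H hξ harg hξ1 (H.norm_zeta 1) (T := {1, 2}) ?_ ?_).congr
        fun n w => ?_
      · intro k
        fin_cases k
        · exact h01.le
        · exact le_rfl
        · exact h12.ge
      · intro k hk
        fin_cases k
        · exact h01
        · simp at hk
        · simp at hk
      · have hζn := pow_ne_zero n hζ0
        -- Taking ω = ζ 1 turns ζ₂^{1-n} ζ₁^n into ζ₁ (ζ₂/ζ₁)^{1-n}; the common ζ₁ moves to the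
        -- outer factor.
        rw [Finset.sum_pair (by decide), sub_self, Complex.cpow_zero, div_zpow,
          zpow_sub₀ hζ0, zpow_one, zpow_natCast, mul_assoc (A 1), div_mul_cancel₀ _ hζn]
        simp only [div_eq_mul_inv, mul_inv, inv_inv]
        field_simp
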